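/- Let $\sigma(s)\in\{1,\ s,\ 1-s^2\}$ and $\tau(s)=\alpha s+\beta$ with real $\alpha,\beta$, and let the interval $(a,b)$ and the weight $\varrho$ be as follows: $\sigma=1$: $\alpha<0$, $(a,b)=(-\infty,\infty)$, $\varrho(s)=e^{\alpha s^2/2+\beta s}$; $\sigma=s$: $\alpha<0<\beta$, $(a,b)=(0,\infty)$, $\varrho(s)=s^{\beta-1}e^{\alpha s}$; $\sigma=1-s^2$: $\alpha<\beta<-\alpha$, $(a,b)=(-1,1)$, $\varrho(s)=(1+s)^{-(\alpha-\beta)/2-1}(1-s)^{-(\alpha+\beta)/2-1}$. Put $\lambda_l=-\frac{\sigma''}{2}l(l-1)-\tau' l$, and for each $l\in\mathbb{N}=\{0,1,2,\dots\}$ let $\Psi_l$ be a nonzero real polynomial of degree at most $l$ with $\sigma\Psi_l''+\tau\Psi_l'+\lambda_l\Psi_l=0$. Let $\mathcal H=L^2((a,b),\varrho\,ds)$ (complex-valued functions, scalar product conjugate-linear in the first argument), $\kappa=\sqrt\sigma$, $\Psi_{l,m}=\kappa^m\,\frac{d^m}{ds^m}\Psi_l$ and $\tilde\Psi_{l,m}=\Psi_{l,m}/\|\Psi_{l,m}\|$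 for $l\ge m$. Fix $m\in\mathbb{N}$ and put $|n\rangle=\tilde\Psi_{m+n,m}$. There is a unique unitary operator $U_m$ of $\mathcal H$ with $U_m\tilde\Psi_{l,m}=\tilde\Psi_{l+1,m+1}$ for all $l\ge m$. Let $A_m=\kappa\frac{d}{ds}-m\kappa'$, defined on all differentiable $f\in\mathcal H$ with $\kappa f'-m\kappa' f\in\mathcal H$, and let $a_m=U_m^{+}A_m$, where $U_m^{+}$ is the adjoint of $U_m$. Operator-valued integrals below are understood weakly: $\int d\mu(z)\,|z\rangle\langle z|=\mathbb I$ means that for all $\varphi,\psi\in\mathcal H$ the function $z\mapsto\langle\varphi|z\rangle\langle z|\psi\rangle$ is $\mu$-integrable with integral $\langle\varphi,\psi\rangle$. (a) If $\sigma\in\{1,s\}$, then for every $z\in\mathbb C$ the series $$|z\rangle=e^{\frac{|z|^2}{2\alpha}}\sum_{n=0}^\infty\frac{z^n}{\sqrt{n!\,(-\alpha)^n}}\,|n\rangle$$ converges in $\mathcal H$, $|z\rangle$ depends continuously on $z$ and lies in the domain of $a_m$, and $$\langle z|z\rangle=1,\qquad a_m|z\rangle=z|z\rangle,\qquad \frac{1}{\pi(-\alpha)}\int_{\mathbb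 C}d(\mathrm{Re}\,z)\,d(\mathrm{Im}\,z)\,|z\rangle\langle z|=\mathbb I .$$ (b) If $\sigma=1-s^2$, then for every $z\in\mathbb C$ the series $$|z\rangle=\sqrt{\Gamma(2m-\alpha)}\sum_{n=0}^\infty\frac{z^n}{\sqrt{n!\,\Gamma(n+2m-\alpha)}}\,|n\rangle$$ converges in $\mathcal H$, $|z\rangle$ depends continuously on $z$ and lies in the domain of $a_m$, and $$\langle z|z\rangle={}_0F_1(2m-\alpha;|z|^2),\qquad a_m|z\rangle=z|z\rangle,\qquad \int_{\mathbb C}d\mu(z)\,|z\rangle\langle z|=\mathbb I,$$ where, with $z=re^{i\theta}$, $\mu$ is the (nonnegative) measure $$d\mu(z)=\frac{2\,r^{2m-\alpha}}{\pi\,\Gamma(2m-\alpha)}\,K_{\alpha+1-2m}(2r)\,dr\,d\theta .$$ Here ${}_0F_1(c;x)=\sum_{n\ge0}\frac{x^n}{c(c+1)\cdots(c+n-1)\,n!}$, and $K_\nu(x)=\frac{\pi}{2}\,\frac{I_{-\nu}(x)-I_\nu(x)}{\sin(\nu\pi)}$ (for integer $\nu$, the limit of this expression in the order) with $I_\nu(x)=\sum_{n\ge0}\frac{(x/2)^{\nu+2n}}{n!\,\Gamma(\nu+n+1)}$.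 -/

import Mathlib

open MeasureTheory Filter Topology Polynomial
open scoped ENNReal InnerProductSpace

noncomputable section

namespace CoherentStates

/-- The three choices `1`, `s`, `1 - s ^ 2` of the leading coefficient `σ`. -/
inductive Kind : Type
  | one
  | lin
  | quad

/-- The polynomial `σ`. -/
def sigma : Kind → ℝ[X]
  | .one => 1
  | .lin => X
  | .quad => 1 - X ^ 2

/-- The polynomial `τ(s) = α s + β`. -/
def tau (α β : ℝ) : ℝ[X] := C α * X + C β

/-- The restrictions on the parameters. -/
def Admissible : Kind → ℝ → ℝ → Prop
  | .one, α, _ => α < 0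
  | .lin, α, β => α < 0 ∧ 0 < β
  | .quad, α, β => α < β ∧ β < -α

/-- The interval `(a, b)`. -/
def interval : Kind → Set ℝ
  | .one => Set.univ
  | .lin => Set.Ioi 0
  | .quad => Set.Ioo (-1) 1

/-- The weight function `ϱ` on `(a, b)`. -/
def weight : Kind → ℝ → ℝ → ℝ → ℝ
  | .one, α, β, s => Real.exp (α * s ^ 2 / 2 + β * s)
  | .lin, α, β, s => s ^ (β - 1) * Real.exp (α * s)
  | .quad, α, β, s => (1 + s) ^ (-(α - β) / 2 - 1) * (1 - s) ^ (-(α + β) / 2 - 1)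

/-- `λ_l = -(σ'' / 2) l (l - 1) - τ' l` (both `σ''` and `τ'` are constants). -/
def lam (k : Kind) (α β : ℝ) (l : ℕ) : ℝ :=
  -((derivative (derivative (sigma k))).coeff 0 / 2) * l * (l - 1)
    - (derivative (tau α β)).coeff 0 * l

/-- `P` is a nonzero polynomial of degree at most `l` with `σ P'' + τ P' + λ_l P = 0`. -/
def IsPolynomialSolution (k : Kind) (α β : ℝ) (l : ℕ) (P : ℝ[X]) : Prop :=
  P ≠ 0 ∧ P.natDegree ≤ l ∧
    sigma k * derivative (derivative P) + tau α β * derivative P + C (lam k α β l) * P = 0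

/-- `κ = √σ`. -/
def kappa (k : Kind) (s : ℝ) : ℝ := √((sigma k).eval s)

/-- The measure `ϱ(s) ds` on `(a, b)`. -/
def wMeasure (k : Kind) (α β : ℝ) : Measure ℝ :=
  (volume.restrict (interval k)).withDensity fun s => ENNReal.ofReal (weight k α β s)

/-- The Hilbert space of complex functions on `(a, b)`, square integrable with weight `ϱ`. -/
abbrev Hil (k : Kind) (α β : ℝ) : Type := Lp ℂ 2 (wMeasure k α β)

/-- The associated special function `Ψ_{l,m} = κ ^ m (d/ds)^m Ψ_l`. -/
def assocFun (k : Kind) (Ψ : ℕ → ℝ[X]) (l m : ℕ) (s : ℝ) : ℝ :=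
  kappa k s ^ m * (derivative^[m] (Ψ l)).eval s

/-- The norm of `Ψ_{l,m}`. -/
def assocNorm (k : Kind) (α β : ℝ) (Ψ : ℕ → ℝ[X]) (l m : ℕ) : ℝ :=
  √(∫ s in interval k, assocFun k Ψ l m s ^ 2 * weight k α β s)

open Classical in
/-- The class in the Hilbert space of a square integrable function. -/
def toHil (k : Kind) (α β : ℝ) (F : ℝ → ℂ) : Hil k α β :=
  if h : MemLp F 2 (wMeasure k α β) then h.toLp F else 0

/-- The normalized associated special function `Ψ_{l,m} / ‖Ψ_{l,m}‖`. -/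
def normAssoc (k : Kind) (α β : ℝ) (Ψ : ℕ → ℝ[X]) (l m : ℕ) : Hil k α β :=
  toHil k α β fun s => ((assocFun k Ψ l m s / assocNorm k α β Ψ l m : ℝ) : ℂ)

/-- The differential expression `κ F' - m κ' F`. -/
def diffExpr (k : Kind) (m : ℕ) (F : ℝ → ℂ) (s : ℝ) : ℂ :=
  (kappa k s : ℂ) * deriv F s - (m : ℂ) * ((deriv (kappa k) s : ℝ) : ℂ) * F s

/-- `F` is a differentiable representative of `f` for which `κ F' - m κ' F` is again in the
Hilbert space. -/
def IsGoodRep (k : Kind) (α β : ℝ) (m : ℕ) (f : Hil k α β) (F : ℝ → ℂ) : Prop :=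
  DifferentiableOn ℝ F (interval k) ∧ F =ᵐ[wMeasure k α β] f ∧
    MemLp (diffExpr k m F) 2 (wMeasure k α β)

theorem isOpen_interval (k : Kind) : IsOpen (interval k) := by
  cases k
  · exact isOpen_univ
  · exact isOpen_Ioi
  · exact isOpen_Ioo

theorem weight_pos (k : Kind) (α β : ℝ) {s : ℝ} (hs : s ∈ interval k) : 0 < weight k α β s := by
  cases k
  · exact Real.exp_pos _
  · exact mul_pos (Real.rpow_pos_of_pos hs _) (Real.exp_pos _)
  · exact mul_pos (Real.rpow_pos_of_pos (by linarith [hs.1]) _)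
      (Real.rpow_pos_of_pos (by linarith [hs.2]) _)

theorem measurable_weight (k : Kind) (α β : ℝ) : Measurable (weight k α β) := by
  cases k <;> unfold weight <;> fun_prop

theorem ae_wMeasure_iff (k : Kind) (α β : ℝ) {p : ℝ → Prop} :
    (∀ᵐ s ∂(wMeasure k α β), p s) ↔ ∀ᵐ s ∂(volume.restrict (interval k)), p s := by
  unfold wMeasure
  rw [ae_withDensity_iff (measurable_weight k α β).ennreal_ofReal]
  constructor <;> intro h
  · filter_upwards [h, ae_restrict_mem (isOpen_interval k).measurableSet] with s h1 h2
    exact h1 (by simpa using weight_pos k α β h2)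
  · filter_upwards [h] with s h1 _ using h1

theorem IsGoodRep.diffExpr_ae_eq {k : Kind} {α β : ℝ} {m : ℕ} {f : Hil k α β} {F G : ℝ → ℂ}
    (hF : IsGoodRep k α β m f F) (hG : IsGoodRep k α β m f G) :
    diffExpr k m F =ᵐ[wMeasure k α β] diffExpr k m G := by
  have hFG : F =ᵐ[volume.restrict (interval k)] G :=
    (ae_wMeasure_iff k α β).1 (hF.2.1.trans hG.2.1.symm)
  have heq : Set.EqOn F G (interval k) :=
    Measure.eqOn_open_of_ae_eq hFG (isOpen_interval k) hF.1.continuousOn hG.1.continuousOn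
  refine (ae_wMeasure_iff k α β).2 ?_
  filter_upwards [ae_restrict_mem (isOpen_interval k).measurableSet] with s hs
  have h1 : F =ᶠ[𝓝 s] G := heq.eventuallyEq_of_mem ((isOpen_interval k).mem_nhds hs)
  unfold diffExpr
  rw [h1.deriv_eq, heq hs]

theorem diffExpr_add_ae {k : Kind} {α β : ℝ} {m : ℕ} {F G : ℝ → ℂ}
    (hF : DifferentiableOn ℝ F (interval k)) (hG : DifferentiableOn ℝ G (interval k)) :
    diffExpr k m (F + G) =ᵐ[wMeasure k α β] diffExpr k m F + diffExpr k m G := by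
  refine (ae_wMeasure_iff k α β).2 ?_
  filter_upwards [ae_restrict_mem (isOpen_interval k).measurableSet] with s hs
  have hs' := (isOpen_interval k).mem_nhds hs
  simp only [diffExpr, Pi.add_apply]
  rw [deriv_add (hF.differentiableAt hs') (hG.differentiableAt hs')]
  ring

theorem diffExpr_smul (k : Kind) (m : ℕ) (c : ℂ) (F : ℝ → ℂ) :
    diffExpr k m (c • F) = c • diffExpr k m F := by
  funext s
  simp only [diffExpr, Pi.smul_apply]
  rw [deriv_const_smul_field]
  simp only [smul_eq_mul]
  ring

theorem IsGoodRep.add {k : Kind} {α β : ℝ} {m : ℕ} {f g : Hil k α β} {F G : ℝ → ℂ}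
    (hF : IsGoodRep k α β m f F) (hG : IsGoodRep k α β m g G) :
    IsGoodRep k α β m (f + g) (F + G) :=
  ⟨hF.1.add hG.1, (hF.2.1.add hG.2.1).trans (Lp.coeFn_add f g).symm,
    (memLp_congr_ae (diffExpr_add_ae hF.1 hG.1)).2 (hF.2.2.add hG.2.2)⟩

theorem IsGoodRep.smul {k : Kind} {α β : ℝ} {m : ℕ} {f : Hil k α β} {F : ℝ → ℂ} (c : ℂ)
    (hF : IsGoodRep k α β m f F) : IsGoodRep k α β m (c • f) (c • F) :=
  ⟨hF.1.const_smul c, (hF.2.1.const_smul c).trans (Lp.coeFn_smul c f).symm, by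
    rw [diffExpr_smul]; exact hF.2.2.const_smul c⟩

theorem isGoodRep_zero (k : Kind) (α β : ℝ) (m : ℕ) : IsGoodRep k α β m 0 0 := by
  have h : diffExpr k m 0 = 0 := by
    funext s
    simp [diffExpr]
  refine ⟨differentiableOn_const 0, (Lp.coeFn_zero ℂ 2 (wMeasure k α β)).symm, ?_⟩
  rw [h]
  exact MemLp.zero

/-- The differential operator `A_m = κ d/ds - m κ'` in the Hilbert space, on the domain of all
classes with a differentiable representative that it maps into the Hilbert space. -/
def opA (k : Kind) (α β : ℝ) (m : ℕ) : Hil k α β →ₗ.[ℂ] Hil k α β where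
  domain :=
    { carrier := {f | ∃ F, IsGoodRep k α β m f F}
      zero_mem' := ⟨0, isGoodRep_zero k α β m⟩
      add_mem' := by
        rintro f g ⟨F, hF⟩ ⟨G, hG⟩
        exact ⟨F + G, hF.add hG⟩
      smul_mem' := by
        rintro c f ⟨F, hF⟩
        exact ⟨c • F, hF.smul c⟩ }
  toFun :=
    { toFun := fun f => MemLp.toLp (diffExpr k m f.2.choose) f.2.choose_spec.2.2
      map_add' := by
        intro f g
        rw [← MemLp.toLp_add, MemLp.toLp_eq_toLp_iff]
        exact ((f + g).2.choose_spec.diffExpr_ae_eq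
          (f.2.choose_spec.add g.2.choose_spec)).trans
          (diffExpr_add_ae f.2.choose_spec.1 g.2.choose_spec.1)
      map_smul' := by
        intro c f
        rw [RingHom.id_apply, ← MemLp.toLp_const_smul, MemLp.toLp_eq_toLp_iff,
          ← diffExpr_smul]
        exact (c • f).2.choose_spec.diffExpr_ae_eq (f.2.choose_spec.smul c) }

/-- `A_m` computed on a representative. -/
theorem opA_apply {k : Kind} {α β : ℝ} {m : ℕ} {f : Hil k α β} {F : ℝ → ℂ}
    (hF : IsGoodRep k α β m f F) :
    opA k α β m ⟨f, F, hF⟩ = hF.2.2.toLp (diffExpr k m F) := by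
  have h : ∃ G, IsGoodRep k α β m f G := ⟨F, hF⟩
  exact (MemLp.toLp_eq_toLp_iff h.choose_spec.2.2 hF.2.2).2 (h.choose_spec.diffExpr_ae_eq hF)

/-- The unitary operator `U` maps `Ψ_{l,m} / ‖Ψ_{l,m}‖` to `Ψ_{l+1,m+1} / ‖Ψ_{l+1,m+1}‖`
for all `l ≥ m`. -/
def IsShift (k : Kind) (α β : ℝ) (Ψ : ℕ → ℝ[X]) (m : ℕ) (U : Hil k α β ≃ₗᵢ[ℂ] Hil k α β) : Prop :=
  ∀ l, m ≤ l → U (normAssoc k α β Ψ l m) = normAssoc k α β Ψ (l + 1) (m + 1)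

/-- The operator `a_m = U_m⁺ A_m`; the adjoint of the unitary operator `U_m` is its inverse. -/
def lowering (k : Kind) (α β : ℝ) (m : ℕ) (U : Hil k α β ≃ₗᵢ[ℂ] Hil k α β) :
    Hil k α β →ₗ.[ℂ] Hil k α β :=
  (U.symm.toLinearEquiv : Hil k α β →ₗ[ℂ] Hil k α β).compPMap (opA k α β m)

/-- The vector `|n⟩ = Ψ_{m+n,m} / ‖Ψ_{m+n,m}‖`. -/
def ket (k : Kind) (α β : ℝ) (Ψ : ℕ → ℝ[X]) (m n : ℕ) : Hil k α β :=
  normAssoc k α β Ψ (m + n) m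

/-- The `n`-th term of the series for `|z⟩` in the cases `σ = 1` and `σ = s`. -/
def termA (k : Kind) (α β : ℝ) (Ψ : ℕ → ℝ[X]) (m : ℕ) (z : ℂ) (n : ℕ) : Hil k α β :=
  (z ^ n / ((√(n.factorial * (-α) ^ n) : ℝ) : ℂ)) • ket k α β Ψ m n

/-- The vector `|z⟩` in the cases `σ = 1` and `σ = s`. -/
def cohA (k : Kind) (α β : ℝ) (Ψ : ℕ → ℝ[X]) (m : ℕ) (z : ℂ) : Hil k α β :=
  ((Real.exp (‖z‖ ^ 2 / (2 * α)) : ℝ) : ℂ) • ∑' n, termA k α β Ψ m z n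

/-- The `n`-th term of the series for `|z⟩` in the case `σ = 1 - s ^ 2`. -/
def termB (k : Kind) (α β : ℝ) (Ψ : ℕ → ℝ[X]) (m : ℕ) (z : ℂ) (n : ℕ) : Hil k α β :=
  (z ^ n / ((√(n.factorial * Real.Gamma (n + 2 * m - α)) : ℝ) : ℂ)) • ket k α β Ψ m n

/-- The vector `|z⟩` in the case `σ = 1 - s ^ 2`. -/
def cohB (k : Kind) (α β : ℝ) (Ψ : ℕ → ℝ[X]) (m : ℕ) (z : ℂ) : Hil k α β :=
  ((√(Real.Gamma (2 * m - α)) : ℝ) : ℂ) • ∑' n, termB k α β Ψ m z n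

/-- The confluent hypergeometric function `₀F₁(c; x)`. -/
def hyp0F1 (c x : ℝ) : ℝ := ∑' n : ℕ, x ^ n / ((ascPochhammer ℝ n).eval c * n.factorial)

/-- The modified Bessel function `I_ν(x)`, `x > 0`. (`1 / Γ` vanishes at the poles of `Γ`.) -/
def besselI (ν x : ℝ) : ℝ :=
  ∑' n : ℕ, (x / 2) ^ (ν + 2 * n) / (n.factorial * Real.Gamma (ν + n + 1))

/-- The quotient `(π / 2) (I_{-ν}(x) - I_ν(x)) / sin(ν π)`, for `ν` not an integer. -/
def besselKQuot (ν x : ℝ) : ℝ :=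
  Real.pi / 2 * ((besselI (-ν) x - besselI ν x) / Real.sin (ν * Real.pi))

open Classical in
/-- The modified Bessel function `K_ν(x)`, `x > 0`; for integer `ν` the quotient is understood as
its limit in the order. -/
def besselK (ν x : ℝ) : ℝ :=
  if ∃ n : ℤ, (n : ℝ) = ν then limUnder (𝓝[≠] ν) fun ν' => besselKQuot ν' x
  else besselKQuot ν x

/-- The density in the variables `r, θ`. -/
def bgDensity (α : ℝ) (m : ℕ) (r : ℝ) : ℝ :=
  2 * r ^ (2 * m - α) / (Real.pi * Real.Gamma (2 * m - α)) * besselK (α + 1 - 2 * m) (2 * r)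

/-- The measure on `ℂ` that is `bgDensity α m r dr dθ` in polar coordinates `z = r e^{iθ}`. -/
def bgMeasure (α : ℝ) (m : ℕ) : Measure ℂ :=
  Measure.map (fun p : ℝ × ℝ => (p.1 : ℂ) * Complex.exp (p.2 * Complex.I))
    ((volume.restrict (Set.Ioi (0 : ℝ) ×ˢ Set.Ioo (-Real.pi) Real.pi)).withDensity
      fun p => ENNReal.ofReal (bgDensity α m p.1))

/-- `c ∫ dμ(z) |v z⟩⟨v z|` is the identity operator, as a weak integral. -/
def ResolvesIdentity {E : Type*} [NormedAddCommGroup E] [InnerProductSpace ℂ E]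
    (c : ℝ) (μ : Measure ℂ) (v : ℂ → E) : Prop :=
  ∀ φ ψ : E, Integrable (fun z => ⟪φ, v z⟫_ℂ * ⟪v z, ψ⟫_ℂ) μ ∧
    (c : ℂ) * ∫ z, ⟪φ, v z⟫_ℂ * ⟪v z, ψ⟫_ℂ ∂μ = ⟪φ, ψ⟫_ℂ

/-- `f` lies in the domain of `T` and `T f = z f`. -/
def IsEigen {E : Type*} [NormedAddCommGroup E] [InnerProductSpace ℂ E]
    (T : E →ₗ.[ℂ] E) (z : ℂ) (f : E) : Prop :=
  ∃ h : f ∈ T.domain, T ⟨f, h⟩ = z • f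

end CoherentStates

end

/-! Differentiating σΨ'' + τΨ' + λ_l Ψ = 0 m times gives an equation of the same type for the m-th
derivative of Ψ_l, with τ + mσ' in place of τ and λ_l - λ_m in place of λ_l, and κ^(2m) ϱ is the
weight of the same family that belongs to it. One integration by parts (`integral_mul_eq`) then
yields both the orthogonality of the Ψ_{l,m}, l ≥ m, and ‖Ψ_{l,m+1}‖² = (λ_l - λ_m) ‖Ψ_{l,m}‖². The
weights have exponential moments, so polynomials are dense and the |n⟩ form a Hilbert basis
(`ketBasis`); U_m carries one such basis to the next.

Since A_m(κ^m P) = κ^(m+1) P', one gets a_m|n⟩ = √g_n |n-1⟩ with g_n = λ_{m+n} - λ_m, which is -αn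
or n(n + 2m - 1 - α). Thus ∑ d_n z^n |n⟩ is formally an eigenvector for z as soon as d_{n+1}
√g_{n+1} = d_n, and the coefficients in (a) and (b) satisfy this. As A_m is a differential operator
on an explicit domain, the formal computation needs a differentiable representative: the series is
differentiated term by term, using locally uniform bounds on the normalized polynomials that grow
only polynomially in n (`exists_abs_normPoly_le`, `exists_isGoodRep_tsum`).

For the resolution of the identity, integration over the angle removes the off-diagonal terms, and
only radial moments remain (`resolvesIdentity_polarMeasure`). In (a) they are Gaussian. In (b) the
function K is rewritten as ∫ t^(-ν-1) e^(-t-y/t) dt (`besselK_eq`), after which Fubini's theorem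
turns the moments into Gamma integrals (`besselG_moment`). That integral representation is proved by
uniqueness for the modified Bessel equation when -1 < ν < 0, then carried to all non-integer orders
by differentiation and reflection, and to integer orders by continuity. -/

noncomputable section

namespace CoherentStates

/-! ### Determinacy of the moment problem under exponential moments. -/

section Moments

open ProbabilityTheory

/-- Finite measures with exponential moments are determined by their moments. -/
theorem measure_ext_of_moments {μ ν : Measure ℝ} [IsFiniteMeasure μ] [IsFiniteMeasure ν] {ε : ℝ}
    (hε : 0 < ε) (hμ : ∀ t, |t| < ε → Integrable (fun x => Real.exp (t * x)) μ)
    (hν : ∀ t, |t| < ε → Integrable (fun x => Real.exp (t * x)) ν)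
    (h : ∀ n : ℕ, ∫ x, x ^ n ∂μ = ∫ x, x ^ n ∂ν) : μ = ν := by
  have hint : ∀ {ρ : Measure ℝ}, (∀ t, |t| < ε → Integrable (fun x => Real.exp (t * x)) ρ) →
      ∀ z : ℂ, z ∈ {z : ℂ | |z.re| < ε} → z.re ∈ interior (integrableExpSet id ρ) := by
    intro ρ hρ z hz
    refine mem_interior.2 ⟨{t | |t| < ε}, fun t ht => hρ t ht,
      isOpen_lt continuous_abs continuous_const, hz⟩
  have hconn : IsPreconnected {z : ℂ | |z.re| < ε} := by
    apply Convex.isPreconnected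
    have : {z : ℂ | |z.re| < ε} = Complex.reLm ⁻¹' (Set.Ioo (-ε) ε) := by
      ext z; simp [abs_lt]
    rw [this]
    exact (convex_Ioo _ _).linear_preimage _
  have h0 : (0 : ℂ) ∈ {z : ℂ | |z.re| < ε} := by simpa using hε
  have haμ : AnalyticOnNhd ℂ (complexMGF id μ) {z : ℂ | |z.re| < ε} :=
    fun z hz => analyticAt_complexMGF (hint hμ z hz)
  have haν : AnalyticOnNhd ℂ (complexMGF id ν) {z : ℂ | |z.re| < ε} :=
    fun z hz => analyticAt_complexMGF (hint hν z hz)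
  -- The derivatives of the complex moment generating function at 0 are the moments. Equal Taylor
  -- series at 0 and the identity theorem on the strip |Re z| < ε then give equality on the
  -- imaginary axis, that is, of the characteristic functions.
  have hder : ∀ n, iteratedDeriv n (complexMGF id μ) 0 = iteratedDeriv n (complexMGF id ν) 0 := by
    intro n
    rw [iteratedDeriv_complexMGF (hint hμ 0 h0), iteratedDeriv_complexMGF (hint hν 0 h0)]
    simp only [zero_mul, Complex.exp_zero, mul_one, id_eq]
    have := congrArg (fun x : ℝ => (x : ℂ)) (h n)
    simp only [← integral_complex_ofReal] at this
    simpa using this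
  have hev : complexMGF id μ =ᶠ[𝓝 0] complexMGF id ν := by
    have h1 := (haμ 0 h0).hasFPowerSeriesAt
    have h2 := (haν 0 h0).hasFPowerSeriesAt
    simp only [hder] at h1
    filter_upwards [h1.eventually_hasSum_sub, h2.eventually_hasSum_sub] with x hx1 hx2
    exact hx1.unique hx2
  have heq := haμ.eqOn_of_preconnected_of_eventuallyEq haν hconn h0 hev
  refine Measure.ext_of_charFun (funext fun t => ?_)
  rw [← complexMGF_id_mul_I, ← complexMGF_id_mul_I]
  exact heq (by simpa using hε)

/-- `ENNReal.ofReal` truncates negative values, so the densities `ofReal (g x)` and `ofReal (-g x)`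
are the positive and negative parts of g. The two finite measures they define have equal moments,
hence coincide, and the two parts can be equal only where both vanish. -/
theorem ae_eq_zero_of_moments {μ : Measure ℝ} {g : ℝ → ℝ} {ε : ℝ} (hg : Measurable g)
    (hε : 0 < ε) (hint : ∀ t, |t| < ε → Integrable (fun x => Real.exp (t * x) * g x) μ)
    (h : ∀ n : ℕ, ∫ x, x ^ n * g x ∂μ = 0) (hpow : ∀ n : ℕ, Integrable (fun x => x ^ n * g x) μ) :
    g =ᵐ[μ] 0 := by
  have hgi : Integrable g μ := by simpa using hint 0 (by simpa using hε)
  have hgn : Integrable (fun x => -g x) μ := hgi.neg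
  have fin1 : IsFiniteMeasure (μ.withDensity fun x => ENNReal.ofReal (g x)) :=
    isFiniteMeasure_withDensity_ofReal hgi.2
  have fin2 : IsFiniteMeasure (μ.withDensity fun x => ENNReal.ofReal (-g x)) :=
    isFiniteMeasure_withDensity_ofReal hgn.2
  have hi : ∀ (u f : ℝ → ℝ), Measurable u → Measurable f → Integrable (fun x => f x * u x) μ →
      Integrable (fun x => f x * max (u x) 0) μ := by
    intro u f hu hf hfu
    refine hfu.mono (by fun_prop) (ae_of_all _ fun x => ?_)
    rw [norm_mul, norm_mul]
    gcongr
    simp only [Real.norm_eq_abs]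
    rcases le_total (u x) 0 with h | h <;> simp [h]
  have hwi : ∀ (u f : ℝ → ℝ), Measurable u → Measurable f → Integrable (fun x => f x * u x) μ →
      Integrable f (μ.withDensity fun x => ENNReal.ofReal (u x)) := by
    intro u f hu hf hfu
    rw [integrable_withDensity_iff hu.ennreal_ofReal (ae_of_all _ fun x => ENNReal.ofReal_lt_top)]
    simpa [ENNReal.toReal_ofReal'] using hi u f hu hf hfu
  have hwe : ∀ (u f : ℝ → ℝ), Measurable u →
      ∫ x, f x ∂(μ.withDensity fun x => ENNReal.ofReal (u x)) = ∫ x, f x * max (u x) 0 ∂μ := by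
    intro u f hu
    rw [integral_withDensity_eq_integral_toReal_smul hu.ennreal_ofReal
      (ae_of_all _ fun x => ENNReal.ofReal_lt_top)]
    simp [ENNReal.toReal_ofReal', mul_comm]
  have key := measure_ext_of_moments (μ := μ.withDensity fun x => ENNReal.ofReal (g x))
    (ν := μ.withDensity fun x => ENNReal.ofReal (-g x)) hε
    (fun t ht => hwi g _ hg (by fun_prop) (hint t ht))
    (fun t ht => hwi (fun x => -g x) _ hg.neg (by fun_prop) (by simpa using (hint t ht).neg))
    (fun n => by
      rw [hwe g _ hg, hwe (fun x => -g x) _ hg.neg, ← sub_eq_zero, ← integral_sub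
        (hi g _ hg (by fun_prop) (hpow n))
        (hi (fun x => -g x) _ hg.neg (by fun_prop) (by simpa using (hpow n).neg))]
      refine Eq.trans ?_ (h n)
      refine integral_congr_ae (ae_of_all _ fun x => ?_)
      dsimp only
      rw [← mul_sub]
      rcases le_total (g x) 0 with h' | h' <;> simp [h'])
  rw [withDensity_eq_iff (by fun_prop) (by fun_prop)] at key
  · filter_upwards [key] with x hx
    have := congrArg ENNReal.toReal hx
    rw [ENNReal.toReal_ofReal', ENNReal.toReal_ofReal'] at this
    rcases le_total (g x) 0 with h | h
    · simpa [h] using this.symm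
    · simpa [h] using this
  · exact (hgi.lintegral_lt_top).ne

end Moments

/-! ### The weights: exponential moments and the Pearson equation. -/

section Weight

open ProbabilityTheory

variable {k : Kind} {α β : ℝ}

theorem Admissible.alpha_neg (h : Admissible k α β) : α < 0 := by
  cases k
  · exact h
  · exact h.1
  · have := h.1; have := h.2; linarith

theorem integrable_wMeasure_iff {E : Type*} [NormedAddCommGroup E] [NormedSpace ℝ E] {f : ℝ → E} :
    Integrable f (wMeasure k α β) ↔ IntegrableOn (fun s => weight k α β s • f s) (interval k) := by
  unfold wMeasure
  rw [integrable_withDensity_iff_integrable_smul' (measurable_weight k α β).ennreal_ofReal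
    (ae_of_all _ fun x => ENNReal.ofReal_lt_top), IntegrableOn]
  refine integrable_congr ?_
  filter_upwards [ae_restrict_mem (isOpen_interval k).measurableSet] with s hs
  rw [ENNReal.toReal_ofReal (weight_pos k α β hs).le]

theorem integral_wMeasure {E : Type*} [NormedAddCommGroup E] [NormedSpace ℝ E] (f : ℝ → E) :
    ∫ s, f s ∂(wMeasure k α β) = ∫ s in interval k, weight k α β s • f s := by
  unfold wMeasure
  rw [integral_withDensity_eq_integral_toReal_smul (measurable_weight k α β).ennreal_ofReal
    (ae_of_all _ fun x => ENNReal.ofReal_lt_top)]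
  refine integral_congr_ae ?_
  filter_upwards [ae_restrict_mem (isOpen_interval k).measurableSet] with s hs
  rw [ENNReal.toReal_ofReal (weight_pos k α β hs).le]

theorem integrableOn_one_add_rpow_mul_one_sub_rpow {a b : ℝ} (ha : 0 < a) (hb : 0 < b) :
    IntegrableOn (fun s : ℝ => (1 + s) ^ (a - 1) * (1 - s) ^ (b - 1)) (Set.Ioo (-1) 1) := by
  -- On [-1, 0] only the factor in 1 + s can be singular; the reflection s ↦ -s exchanges the two
  -- exponents and gives the other half.
  have half : ∀ {a b : ℝ}, 0 < a →
      IntervalIntegrable (fun s : ℝ => (1 + s) ^ (a - 1) * (1 - s) ^ (b - 1)) volume (-1) 0 := by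
    intro a b ha
    refine IntervalIntegrable.mul_continuousOn ?_ ?_
    · have := (intervalIntegral.intervalIntegrable_rpow' (a := 0) (b := 1)
        (show -1 < a - 1 by linarith)).comp_add_left 1
      rwa [zero_sub, sub_self] at this
    · intro s hs
      rw [Set.uIcc_of_le (by norm_num)] at hs
      exact ((continuousAt_const.sub continuousAt_id).rpow_const
        (Or.inl (show (0 : ℝ) < 1 - s by linarith [hs.2]).ne')).continuousWithinAt
  have h1 := half (b := b) ha
  have h2 : IntervalIntegrable (fun s : ℝ => (1 + s) ^ (a - 1) * (1 - s) ^ (b - 1)) volume 0 1 := by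
    have := (half (b := a) hb).comp_sub_left 0
    simp only [zero_sub, sub_neg_eq_add, zero_add, neg_zero] at this
    refine this.symm.congr fun s _ => ?_
    simp only [← sub_eq_add_neg, mul_comm]
  exact ((intervalIntegrable_iff_integrableOn_Ioc_of_le (by norm_num)).1 (h1.trans h2)).mono_set
    Set.Ioo_subset_Ioc_self

theorem integrableOn_exp_mul_weight (h : Admissible k α β) : ∃ ε > 0, ∀ t : ℝ, |t| < ε →
    IntegrableOn (fun s => weight k α β s * Real.exp (t * s)) (interval k) := by
  cases k
  · refine ⟨1, one_pos, fun t _ => ?_⟩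
    have h1 := integrable_cexp_quadratic' (b := ((α / 2 : ℝ) : ℂ))
      (by rw [Complex.ofReal_re]; linarith [show α < 0 from h]) ((β + t : ℝ) : ℂ) 0
    have h2 := h1.norm
    simp only [interval, integrableOn_univ]
    refine h2.congr (ae_of_all _ fun s => ?_)
    simp only [weight]
    rw [Complex.norm_exp, ← Real.exp_add]
    congr 1
    simp [← Complex.ofReal_pow]
    ring
  -- For t < -α the exponential e^((α + t) s) still decays.
  · refine ⟨-α, by linarith [h.1], fun t ht => ?_⟩
    have h1 := integrableOn_rpow_mul_exp_neg_mul_rpow (p := 1) (s := β - 1) (b := -α - t)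
      (by linarith [h.2]) one_pos (by linarith [(abs_lt.1 ht).2])
    refine h1.congr_fun (fun s _ => ?_) measurableSet_Ioi
    simp only [weight, Real.rpow_one]
    rw [mul_assoc, ← Real.exp_add]
    ring_nf
  · refine ⟨1, one_pos, fun t _ => ?_⟩
    have h1 := integrableOn_one_add_rpow_mul_one_sub_rpow (a := -(α - β) / 2) (b := -(α + β) / 2)
      (by linarith [h.1]) (by linarith [h.2])
    have : Continuous fun s : ℝ => Real.exp (t * s) := by fun_prop
    exact ((h1.integrable.mul_bdd (c := Real.exp |t|)
      this.aestronglyMeasurable) ((ae_restrict_mem measurableSet_Ioo).mono fun s hs => by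
        rw [Real.norm_eq_abs, Real.abs_exp, Real.exp_le_exp]
        calc t * s ≤ |t * s| := le_abs_self _
          _ = |t| * |s| := abs_mul _ _
          _ ≤ |t| * 1 := by gcongr; exact (abs_lt.2 hs).le
          _ = |t| := mul_one _))

theorem mem_interior_integrableExpSet (h : Admissible k α β) : ∃ ε > 0, ∀ t : ℝ, |t| < ε →
    t ∈ interior (integrableExpSet id (wMeasure k α β)) := by
  obtain ⟨ε, hε, H⟩ := integrableOn_exp_mul_weight h
  refine ⟨ε, hε, fun t ht => mem_interior.2 ⟨{t | |t| < ε}, fun t ht => ?_,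
      isOpen_lt continuous_abs continuous_const, ht⟩⟩
  exact integrable_wMeasure_iff.2 (H t ht)

theorem integrable_eval_mul_exp {t : ℝ}
    (ht : t ∈ interior (integrableExpSet id (wMeasure k α β))) (P : ℝ[X]) :
    Integrable (fun s => P.eval s * Real.exp (t * s)) (wMeasure k α β) := by
  induction P using Polynomial.induction_on' with
  | add p q hp hq => exact (hp.add hq).congr (ae_of_all _ fun s => by simp [add_mul])
  | monomial n a =>
    simpa [mul_assoc] using
      (integrable_pow_mul_exp_of_mem_interior_integrableExpSet ht n).const_mul a

theorem integrable_eval (h : Admissible k α β) (P : ℝ[X]) :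
    Integrable (fun s => P.eval s) (wMeasure k α β) := by
  obtain ⟨ε, hε, H⟩ := mem_interior_integrableExpSet h
  simpa using integrable_eval_mul_exp (H 0 (by simpa using hε)) P

/-- By the Pearson equation (σϱ)' = τϱ the integrand, multiplied by ϱ, is the derivative of σϱR.
Admissibility of the parameters makes σϱR vanish at the ends of the interval. -/
theorem integral_tau_mul_add_sigma_mul_derivative (h : Admissible k α β) (R : ℝ[X]) :
    ∫ s, (tau α β * R + sigma k * derivative R).eval s ∂(wMeasure k α β) = 0 := by
  have hint := integrable_wMeasure_iff.1 (integrable_eval h (tau α β * R + sigma k * derivative R))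
  have hint' := integrable_wMeasure_iff.1 (integrable_eval h (sigma k * R))
  rw [integral_wMeasure]
  simp only [smul_eq_mul] at hint hint' ⊢
  cases k
  · simp only [interval, Measure.restrict_univ, integrableOn_univ] at *
    refine integral_eq_zero_of_hasDerivAt_of_integrable (fun s => ?_) hint hint'
    have h1 : HasDerivAt (fun s : ℝ => α * s ^ 2 / 2 + β * s) (α * s + β) s := by
      have := (((hasDerivAt_pow 2 s).const_mul α).div_const 2).add ((hasDerivAt_id s).const_mul β)
      convert! this using 1
      simp; ring
    have h2 := h1.exp.mul (R.hasDerivAt s)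
    convert! h2 using 1
    · ext s; simp [sigma, weight]
    · simp [sigma, tau, weight]; ring
  · have hd : ∀ s ∈ Set.Ioi (0 : ℝ), HasDerivAt (fun s : ℝ => s ^ β * (Real.exp (α * s) * R.eval s))
        (weight .lin α β s * (tau α β * R + sigma .lin * derivative R).eval s) s := by
      intro s hs
      have h1 : HasDerivAt (fun s : ℝ => α * s) α s := by
        simpa using (hasDerivAt_id s).const_mul α
      have h2 := (Real.hasDerivAt_rpow_const (p := β) (Or.inl (ne_of_gt hs))).mul
        (h1.exp.mul (R.hasDerivAt s))
      convert! h2 using 1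
      have : s ^ β = s ^ (β - 1) * s := by
        rw [← Real.rpow_add_one (ne_of_gt hs)]; ring_nf
      simp only [weight, tau, sigma, eval_add, eval_mul, eval_C, eval_X, this, Pi.mul_apply]
      ring
    have hi : IntegrableOn (fun s : ℝ => s ^ β * (Real.exp (α * s) * R.eval s)) (Set.Ioi 0) := by
      refine hint'.congr_fun (fun s hs => ?_) measurableSet_Ioi
      have : s ^ β = s ^ (β - 1) * s := by
        rw [← Real.rpow_add_one (ne_of_gt hs)]; ring_nf
      simp only [weight, sigma, eval_mul, eval_X, this]
      ring
    -- The limit at infinity costs no estimate: a function integrable together with its derivative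
    -- tends to 0.
    have hlim := tendsto_zero_of_hasDerivAt_of_integrableOn_Ioi hd hint hi
    have := integral_Ioi_of_hasDerivAt_of_tendsto ?_ hd hint hlim
    · simp only [interval]
      rw [this, Real.zero_rpow (ne_of_gt h.2)]
      simp
    · refine ContinuousAt.continuousWithinAt ?_
      exact (Real.continuousAt_rpow_const _ _ (Or.inr h.2.le)).mul
        (Continuous.continuousAt (by fun_prop))
  -- Here σϱ = (1 + s)^a (1 - s)^b, and admissibility says exactly that a and b are positive.
  · set a := -(α - β) / 2 with ha
    set b := -(α + β) / 2 with hb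
    have ha0 : 0 < a := by linarith [h.1]
    have hb0 : 0 < b := by linarith [h.2]
    have hd : ∀ s ∈ Set.Ioo (-1 : ℝ) 1,
        HasDerivAt (fun s : ℝ => (1 + s) ^ a * ((1 - s) ^ b * R.eval s))
        (weight .quad α β s * (tau α β * R + sigma .quad * derivative R).eval s) s := by
      intro s hs
      have hs1 : 0 < 1 + s := by linarith [hs.1]
      have hs2 : 0 < 1 - s := by linarith [hs.2]
      have h1 := ((hasDerivAt_id s).const_add 1).rpow_const (p := a) (Or.inl hs1.ne')
      have h2 := ((hasDerivAt_id s).const_sub 1).rpow_const (p := b) (Or.inl hs2.ne')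
      have h3 := h1.mul (h2.mul (R.hasDerivAt s))
      convert! h3 using 1
      have e1 : (1 + s) ^ a = (1 + s) ^ (a - 1) * (1 + s) := by
        rw [← Real.rpow_add_one hs1.ne']; ring_nf
      have e2 : (1 - s) ^ b = (1 - s) ^ (b - 1) * (1 - s) := by
        rw [← Real.rpow_add_one hs2.ne']; ring_nf
      simp only [weight, tau, sigma, eval_add, eval_mul, eval_C, eval_X, eval_sub, eval_one,
        eval_pow, id, Pi.mul_apply]
      rw [← ha, ← hb, e1, e2]
      simp only [ha, hb]
      ring
    have hc : ContinuousOn (fun s : ℝ => (1 + s) ^ a * ((1 - s) ^ b * R.eval s))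
        (Set.Icc (-1) 1) := by
      refine Continuous.continuousOn ?_
      have h1 : Continuous fun s : ℝ => (1 + s) ^ a :=
        (continuous_const.add continuous_id).rpow_const fun _ => Or.inr ha0.le
      have h2 : Continuous fun s : ℝ => (1 - s) ^ b :=
        (continuous_const.sub continuous_id).rpow_const fun _ => Or.inr hb0.le
      exact h1.mul (h2.mul R.continuous)
    have := intervalIntegral.integral_eq_sub_of_hasDerivAt_of_le (by norm_num) hc hd
      ((intervalIntegrable_iff_integrableOn_Ioo_of_le (by norm_num)).2 hint)
    rw [intervalIntegral.integral_of_le (by norm_num), integral_Ioc_eq_integral_Ioo] at this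
    simp only [interval]
    rw [this]
    simp [Real.zero_rpow ha0.ne', Real.zero_rpow hb0.ne']

/-- Integration by parts. -/
theorem integral_mul_sturmLiouville (h : Admissible k α β) (P Q : ℝ[X]) :
    ∫ s, (Q * (sigma k * derivative (derivative P) + tau α β * derivative P)).eval s
      ∂(wMeasure k α β) =
    -∫ s, (sigma k * derivative P * derivative Q).eval s ∂(wMeasure k α β) := by
  rw [eq_neg_iff_add_eq_zero, ← integral_add (integrable_eval h _) (integrable_eval h _)]
  refine Eq.trans ?_ (integral_tau_mul_add_sigma_mul_derivative h (derivative P * Q))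
  refine integral_congr_ae (ae_of_all _ fun s => ?_)
  simp only [derivative_mul, eval_add, eval_mul]
  ring

end Weight

/-! ### The weights κ^(2m) ϱ belong to the same three families. -/

section Shift

/-- The parameter `α` of the weight `κ ^ (2 m) ϱ`. -/
def shiftAlpha : Kind → ℝ → ℕ → ℝ
  | .quad, α, m => α - 2 * m
  | _, α, _ => α

/-- The parameter `β` of the weight `κ ^ (2 m) ϱ`. -/
def shiftBeta : Kind → ℝ → ℕ → ℝ
  | .lin, β, m => β + m
  | _, β, _ => β

variable {k : Kind} {α β : ℝ}

theorem Admissible.shift (h : Admissible k α β) (m : ℕ) :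
    Admissible k (shiftAlpha k α m) (shiftBeta k β m) := by
  have : (0 : ℝ) ≤ m := m.cast_nonneg
  cases k
  · exact h
  · exact ⟨h.1, by simp only [shiftBeta]; linarith [h.2]⟩
  · exact ⟨by simp only [shiftAlpha, shiftBeta]; linarith [h.1],
      by simp only [shiftAlpha, shiftBeta]; linarith [h.2]⟩

theorem sigma_eval_pos {s : ℝ} (hs : s ∈ interval k) : 0 < (sigma k).eval s := by
  cases k
  · simp [sigma]
  · simpa [sigma] using (show (0 : ℝ) < s from hs)
  · simp only [sigma, eval_sub, eval_one, eval_pow, eval_X]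
    nlinarith [hs.1, hs.2]

theorem kappa_sq {s : ℝ} (hs : s ∈ interval k) : kappa k s ^ 2 = (sigma k).eval s :=
  Real.sq_sqrt (sigma_eval_pos hs).le

theorem kappa_pos {s : ℝ} (hs : s ∈ interval k) : 0 < kappa k s :=
  Real.sqrt_pos.2 (sigma_eval_pos hs)

/-- This lets every statement about ϱ be applied to κ^(2m) ϱ by a change of parameters. -/
theorem weight_shift {s : ℝ} (hs : s ∈ interval k) (m : ℕ) :
    weight k (shiftAlpha k α m) (shiftBeta k β m) s = (sigma k).eval s ^ m * weight k α β s := by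
  cases k
  · simp [weight, shiftAlpha, shiftBeta, sigma]
  · simp only [weight, shiftAlpha, shiftBeta, sigma, eval_X]
    have hs : (0 : ℝ) < s := hs
    rw [← mul_assoc, ← Real.rpow_natCast, ← Real.rpow_add hs]
    ring_nf
  · have hs1 : 0 < 1 + s := by linarith [hs.1]
    have hs2 : 0 < 1 - s := by linarith [hs.2]
    simp only [weight, shiftAlpha, shiftBeta, sigma, eval_sub, eval_one, eval_pow, eval_X]
    rw [show 1 - s ^ 2 = (1 + s) * (1 - s) by ring, mul_pow,
      show ∀ a b c d : ℝ, a * b * (c * d) = (a * c) * (b * d) by intros; ring,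
      ← Real.rpow_natCast, ← Real.rpow_natCast, ← Real.rpow_add hs1, ← Real.rpow_add hs2]
    ring_nf

/-- The coefficient matches the Pearson equation of the new weight, (σ^(m+1) ϱ)' = (τ + mσ') σ^m ϱ,
and it is also the first-order coefficient produced by m differentiations of the equation. -/
theorem tau_shift (m : ℕ) : tau (shiftAlpha k α m) (shiftBeta k β m) =
    tau α β + (m : ℝ[X]) * derivative (sigma k) := by
  cases k <;> simp [tau, shiftAlpha, shiftBeta, sigma] <;> ring_nf
  simp [map_ofNat]; ring

end Shift

/-! ### Derivatives of the differential equation; exact degrees. -/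

section Equation

variable {k : Kind} {α β : ℝ} {Ψ : ℕ → ℝ[X]}

/-- The difference `λ_{m+n} - λ_m`. -/
def gap : Kind → ℝ → ℕ → ℕ → ℝ
  | .quad, α, m, n => n * (n + 2 * m - 1 - α)
  | _, α, _, n => n * (-α)

theorem lam_sub_lam (k : Kind) (α β : ℝ) (m n : ℕ) :
    lam k α β (m + n) - lam k α β m = gap k α m n := by
  cases k <;> simp [lam, gap, sigma, tau, coeff_one] <;> ring

theorem gap_pos (h : Admissible k α β) (m n : ℕ) : 0 < gap k α m (n + 1) := by
  have h0 := h.alpha_neg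
  cases k
  · simp only [gap]; push_cast; nlinarith [n.cast_nonneg (α := ℝ)]
  · simp only [gap]; push_cast; nlinarith [n.cast_nonneg (α := ℝ)]
  · simp only [gap]
    have : (0 : ℝ) ≤ n := n.cast_nonneg
    have : (0 : ℝ) ≤ m := m.cast_nonneg
    push_cast
    exact mul_pos (by linarith) (by linarith)

theorem gap_zero (k : Kind) (α : ℝ) (m : ℕ) : gap k α m 0 = 0 := by
  cases k <;> simp [gap]

theorem lam_strictMono (h : Admissible k α β) : StrictMono (lam k α β) :=
  strictMono_nat_of_lt_succ fun n => by
    have := lam_sub_lam k α β n 1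
    have := gap_pos h n 0
    linarith

theorem lam_succ_sub (k : Kind) (α β : ℝ) (m : ℕ) : C (lam k α β (m + 1) - lam k α β m) =
    -((m : ℝ[X]) * derivative (derivative (sigma k)) + derivative (tau α β)) := by
  rw [lam_sub_lam]
  cases k
  · simp [gap, sigma, tau]
  · simp [gap, sigma, tau]
  · simp [gap, sigma, tau, map_ofNat]; ring

/-- Each differentiation adds σ' to the first-order coefficient and the constant mσ'' + τ' to the
zeroth-order one; by `lam_succ_sub` this constant is λ_m - λ_{m+1}, so the sum telescopes. -/
theorem iterate_derivative_equation (hΨ : ∀ l, IsPolynomialSolution k α β l (Ψ l)) (l m : ℕ) :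
    sigma k * derivative (derivative (derivative^[m] (Ψ l)))
      + tau (shiftAlpha k α m) (shiftBeta k β m) * derivative (derivative^[m] (Ψ l))
      = -(C (lam k α β l - lam k α β m) * derivative^[m] (Ψ l)) := by
  induction m with
  | zero =>
    have h0 : lam k α β 0 = 0 := by simp [lam]
    have := (hΨ l).2.2
    rw [tau_shift, h0]
    simp only [Function.iterate_zero, id, Nat.cast_zero, zero_mul, add_zero, sub_zero]
    linear_combination this
  | succ m ih =>
    have hd := congrArg derivative ih
    rw [tau_shift] at hd ⊢
    rw [Function.iterate_succ_apply']
    have h1 := lam_succ_sub k α β m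
    simp only [derivative_add, derivative_mul, derivative_neg, derivative_C, derivative_natCast,
      zero_mul, zero_add] at hd
    push_cast
    simp only [C_sub] at hd h1 ⊢
    linear_combination hd - derivative (derivative^[m] (Ψ l)) * h1

/-- If the degree is d, the d-th derivative is a nonzero constant, and the equation differentiated d
times reduces to (λ_l - λ_d) times that constant being 0. As λ is strictly increasing, d = l. -/
theorem natDegree_solution (h : Admissible k α β) (hΨ : ∀ l, IsPolynomialSolution k α β l (Ψ l))
    (l : ℕ) : (Ψ l).natDegree = l := by
  set d := (Ψ l).natDegree with hd
  have hz : derivative (derivative^[d] (Ψ l)) = 0 := by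
    rw [← Function.iterate_succ_apply' derivative]
    exact iterate_derivative_eq_zero (Nat.lt_succ_self _)
  have hne : derivative^[d] (Ψ l) ≠ 0 := by
    intro h0
    have h1 := congrArg (fun p => p.coeff 0) h0
    simp only [coeff_iterate_derivative, zero_add, coeff_zero, nsmul_eq_mul] at h1
    rw [mul_eq_zero] at h1
    rcases h1 with h1 | h1
    · simp only [Nat.descFactorial_self, Nat.cast_eq_zero] at h1
      exact Nat.factorial_ne_zero _ h1
    · exact (hΨ l).1 (leadingCoeff_eq_zero.1 h1)
  have heq := iterate_derivative_equation hΨ l d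
  rw [hz] at heq
  simp only [derivative_zero, mul_zero, add_zero] at heq
  have h2 := neg_eq_zero.1 heq.symm
  rw [mul_eq_zero, C_eq_zero, sub_eq_zero] at h2
  exact ((lam_strictMono h).injective (h2.resolve_right hne)).symm

theorem degree_iterate_derivative (h : Admissible k α β)
    (hΨ : ∀ l, IsPolynomialSolution k α β l (Ψ l)) (m n : ℕ) :
    (derivative^[m] (Ψ (m + n))).degree = n := by
  suffices H : ∀ m l, m ≤ l → (derivative^[m] (Ψ l)).degree = (l - m : ℕ) by
    rw [H m _ (Nat.le_add_right _ _), Nat.add_sub_cancel_left]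
  intro m l
  induction m with
  | zero =>
    intro _
    simp only [Function.iterate_zero, id, Nat.sub_zero]
    rw [degree_eq_natDegree (hΨ l).1, natDegree_solution h hΨ]
  | succ m ih =>
    intro hm
    have h1 := ih (by omega)
    have h2 := natDegree_eq_of_degree_eq_some h1
    rw [Function.iterate_succ_apply', degree_derivative (by omega), h2]
    congr 1

end Equation

/-! ### Orthogonality, norms and the ladder of derivatives. -/

section Inner

variable {k : Kind} {α β : ℝ} {Ψ : ℕ → ℝ[X]}

theorem integral_shift (m : ℕ) (P : ℝ[X]) :
    ∫ s, P.eval s ∂(wMeasure k (shiftAlpha k α m) (shiftBeta k β m)) =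
      ∫ s, (sigma k ^ m * P).eval s ∂(wMeasure k α β) := by
  rw [integral_wMeasure, integral_wMeasure]
  refine setIntegral_congr_fun (isOpen_interval k).measurableSet fun s hs => ?_
  simp only [weight_shift hs, eval_mul, eval_pow, smul_eq_mul]
  ring

theorem continuous_kappa (k : Kind) : Continuous (kappa k) := by
  unfold kappa; fun_prop

/-- The function `κ ^ m P`. -/
def polyFun (k : Kind) (m : ℕ) (P : ℝ[X]) (s : ℝ) : ℂ := ((kappa k s ^ m * P.eval s : ℝ) : ℂ)

theorem continuous_polyFun (k : Kind) (m : ℕ) (P : ℝ[X]) : Continuous (polyFun k m P) := by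
  have := continuous_kappa k
  unfold polyFun; fun_prop

theorem ae_mem_interval (k : Kind) (α β : ℝ) : ∀ᵐ s ∂(wMeasure k α β), s ∈ interval k :=
  (ae_wMeasure_iff k α β).2 (ae_restrict_mem (isOpen_interval k).measurableSet)

/-- The exponential factor is needed for the moment argument behind completeness. Squaring doubles
the exponent, whence the condition on 2t. -/
theorem memLp_polyFun_mul_exp {t : ℝ}
    (ht : 2 * t ∈ interior (ProbabilityTheory.integrableExpSet id (wMeasure k α β))) (m : ℕ)
    (P : ℝ[X]) :
    MemLp (fun s => polyFun k m P s * (Real.exp (t * s) : ℝ)) 2 (wMeasure k α β) := by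
  have hc := continuous_polyFun k m P
  rw [memLp_two_iff_integrable_sq_norm (Continuous.aestronglyMeasurable (by fun_prop))]
  refine (integrable_eval_mul_exp ht (sigma k ^ m * P ^ 2)).congr ?_
  filter_upwards [ae_mem_interval k α β] with s hs
  rw [norm_mul, polyFun, Complex.norm_real, Complex.norm_real, mul_pow, Real.norm_eq_abs,
    Real.norm_eq_abs, sq_abs, sq_abs, mul_pow, ← pow_mul, mul_comm m 2, pow_mul, kappa_sq hs,
    ← Real.exp_nat_mul]
  simp only [eval_mul, eval_pow]
  push_cast
  ring_nf

theorem memLp_polyFun (h : Admissible k α β) (m : ℕ) (P : ℝ[X]) :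
    MemLp (polyFun k m P) 2 (wMeasure k α β) := by
  obtain ⟨ε, hε, H⟩ := mem_interior_integrableExpSet h
  simpa using memLp_polyFun_mul_exp (t := 0) (H (2 * 0) (by simpa using hε)) m P

/-- The class of `κ ^ m P`. -/
def polyVec (k : Kind) (α β : ℝ) (m : ℕ) (P : ℝ[X]) : Hil k α β :=
  toHil k α β (polyFun k m P)

theorem coeFn_polyVec (h : Admissible k α β) (m : ℕ) (P : ℝ[X]) :
    polyVec k α β m P =ᵐ[wMeasure k α β] polyFun k m P := by
  rw [polyVec, toHil, dif_pos (memLp_polyFun h m P)]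
  exact MemLp.coeFn_toLp _

theorem inner_polyVec (h : Admissible k α β) (m : ℕ) (P Q : ℝ[X]) :
    ⟪polyVec k α β m P, polyVec k α β m Q⟫_ℂ =
      ((∫ s, (sigma k ^ m * (P * Q)).eval s ∂(wMeasure k α β) : ℝ) : ℂ) := by
  rw [L2.inner_def, ← integral_complex_ofReal]
  refine integral_congr_ae ?_
  filter_upwards [coeFn_polyVec h m P, coeFn_polyVec h m Q, ae_mem_interval k α β] with s h1 h2 hs
  rw [h1, h2, RCLike.inner_apply]
  simp only [polyFun, Complex.conj_ofReal, ← Complex.ofReal_mul, eval_mul, eval_pow, ← kappa_sq hs]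
  congr 1
  ring

/-- The squared norm of `Ψ_{l,m}`. -/
def normSq (k : Kind) (α β : ℝ) (Ψ : ℕ → ℝ[X]) (l m : ℕ) : ℝ :=
  ∫ s, (sigma k ^ m * (derivative^[m] (Ψ l)) ^ 2).eval s ∂(wMeasure k α β)

theorem assocNorm_eq (k : Kind) (α β : ℝ) (Ψ : ℕ → ℝ[X]) (l m : ℕ) :
    assocNorm k α β Ψ l m = √(normSq k α β Ψ l m) := by
  rw [assocNorm, normSq, integral_wMeasure]
  congr 1
  refine setIntegral_congr_fun (isOpen_interval k).measurableSet fun s hs => ?_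
  simp only [assocFun, eval_mul, eval_pow, ← kappa_sq hs, smul_eq_mul]
  ring

/-- Integration by parts for the weight κ^(2m) ϱ, combined with the m times differentiated equation.
Taking Q equal to the m-th derivative of Ψ_l gives the norm ratio; taking that of Ψ_j gives
orthogonality. -/
theorem integral_mul_eq (h : Admissible k α β) (hΨ : ∀ l, IsPolynomialSolution k α β l (Ψ l))
    (l m : ℕ) (Q : ℝ[X]) :
    ∫ s, (sigma k ^ (m + 1) * (derivative (derivative^[m] (Ψ l)) * derivative Q)).eval s
        ∂(wMeasure k α β) =
      (lam k α β l - lam k α β m) *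
        ∫ s, (sigma k ^ m * (derivative^[m] (Ψ l) * Q)).eval s ∂(wMeasure k α β) := by
  have h1 := integral_mul_sturmLiouville (h.shift m) (derivative^[m] (Ψ l)) Q
  rw [iterate_derivative_equation hΨ, integral_shift, integral_shift, eq_neg_iff_add_eq_zero] at h1
  rw [← integral_const_mul, ← sub_eq_zero, ← h1, sub_eq_add_neg, add_comm, ← integral_neg]
  congr 1
  · refine integral_congr_ae (ae_of_all _ fun s => ?_)
    simp only [eval_mul, eval_pow, eval_neg, eval_C]
    ring
  · refine integral_congr_ae (ae_of_all _ fun s => ?_)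
    simp only [eval_mul, eval_pow]
    ring

theorem normSq_succ (h : Admissible k α β) (hΨ : ∀ l, IsPolynomialSolution k α β l (Ψ l))
    (l m : ℕ) : normSq k α β Ψ l (m + 1) = (lam k α β l - lam k α β m) * normSq k α β Ψ l m := by
  have := integral_mul_eq h hΨ l m (derivative^[m] (Ψ l))
  simp only [normSq, sq, Function.iterate_succ_apply']
  exact this

/-- The left side of `integral_mul_eq` is symmetric in the two solutions, while the factors λ_l -
λ_m and λ_j - λ_m differ. -/
theorem integral_mul_eq_zero (h : Admissible k α β)
    (hΨ : ∀ l, IsPolynomialSolution k α β l (Ψ l)) {l j : ℕ} (hlj : l ≠ j) (m : ℕ) :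
    ∫ s, (sigma k ^ m * (derivative^[m] (Ψ l) * derivative^[m] (Ψ j))).eval s ∂(wMeasure k α β)
      = 0 := by
  have h1 := integral_mul_eq h hΨ l m (derivative^[m] (Ψ j))
  have h2 := integral_mul_eq h hΨ j m (derivative^[m] (Ψ l))
  rw [mul_comm (derivative (derivative^[m] (Ψ j))), h1, mul_comm (derivative^[m] (Ψ j)),
    ← sub_eq_zero, ← sub_mul, mul_eq_zero] at h2
  refine h2.resolve_left fun h3 => hlj ((lam_strictMono h).injective ?_)
  linarith

theorem wMeasure_ne_zero_of_finite (s : Set ℝ) (hs : s.Finite) :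
    ¬ ∀ᵐ x ∂(wMeasure k α β), x ∈ s := by
  rw [ae_wMeasure_iff]
  intro h
  have h1 : ∀ᵐ x ∂(volume.restrict (interval k)), x ∉ s :=
    ae_restrict_of_ae (measure_eq_zero_iff_ae_notMem.1 (hs.measure_zero volume))
  have h2 : volume.restrict (interval k) = 0 := by
    rw [← ae_eq_bot, ← eventually_false_iff_eq_bot]
    filter_upwards [h, h1] with x h h' using h' h
  rw [Measure.restrict_eq_zero] at h2
  refine ((isOpen_interval k).measure_pos volume ?_).ne' h2
  cases k
  · exact ⟨0, trivial⟩
  · exact ⟨1, show (0 : ℝ) < 1 from one_pos⟩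
  · exact ⟨0, by norm_num, by norm_num⟩

theorem integral_sq_pos (h : Admissible k α β) (m : ℕ) {P : ℝ[X]} (hP : P ≠ 0) :
    0 < ∫ s, (sigma k ^ m * P ^ 2).eval s ∂(wMeasure k α β) := by
  have hnn : 0 ≤ᵐ[wMeasure k α β] fun s => (sigma k ^ m * P ^ 2).eval s := by
    filter_upwards [ae_mem_interval k α β] with s hs
    have := sigma_eval_pos hs
    simp only [eval_mul, eval_pow, Pi.zero_apply]
    positivity
  refine lt_of_le_of_ne (integral_nonneg_of_ae hnn) fun h0 => ?_
  rw [eq_comm, integral_eq_zero_iff_of_nonneg_ae hnn (integrable_eval h _)] at h0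
  refine wMeasure_ne_zero_of_finite (k := k) (α := α) (β := β) {x | P.IsRoot x}
    (finite_setOfPred_isRoot hP) ?_
  filter_upwards [h0, ae_mem_interval k α β] with s h1 hs
  have h2 := sigma_eval_pos hs
  rw [eval_mul, eval_pow, eval_pow, Pi.zero_apply, mul_eq_zero] at h1
  exact eq_zero_of_pow_eq_zero (h1.resolve_left (pow_pos h2 m).ne')

/-- The polynomial part of the normalized associated special functions. -/
def normPoly (k : Kind) (α β : ℝ) (Ψ : ℕ → ℝ[X]) (l m : ℕ) : ℝ[X] :=
  C (assocNorm k α β Ψ l m)⁻¹ * derivative^[m] (Ψ l)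

theorem normAssoc_eq (k : Kind) (α β : ℝ) (Ψ : ℕ → ℝ[X]) (l m : ℕ) :
    normAssoc k α β Ψ l m = polyVec k α β m (normPoly k α β Ψ l m) := by
  rw [normAssoc, polyVec]
  congr 1 with s
  simp only [polyFun, assocFun, normPoly, eval_mul, eval_C]
  congr 1
  ring

theorem normSq_pos (h : Admissible k α β) (hΨ : ∀ l, IsPolynomialSolution k α β l (Ψ l))
    (m n : ℕ) : 0 < normSq k α β Ψ (m + n) m := by
  refine integral_sq_pos h m ?_
  rw [← degree_ne_bot, degree_iterate_derivative h hΨ]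
  exact WithBot.natCast_ne_bot n

theorem orthonormal_ket (h : Admissible k α β) (hΨ : ∀ l, IsPolynomialSolution k α β l (Ψ l))
    (m : ℕ) : Orthonormal ℂ (ket k α β Ψ m) := by
  rw [orthonormal_iff_ite]
  intro i j
  simp only [ket]
  rw [normAssoc_eq, normAssoc_eq, inner_polyVec h]
  have e : ∀ s, (sigma k ^ m * (normPoly k α β Ψ (m + i) m * normPoly k α β Ψ (m + j) m)).eval s =
      ((assocNorm k α β Ψ (m + i) m)⁻¹ * (assocNorm k α β Ψ (m + j) m)⁻¹) *
      (sigma k ^ m * (derivative^[m] (Ψ (m + i)) * derivative^[m] (Ψ (m + j)))).eval s := by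
    intro s
    simp only [normPoly, eval_mul, eval_C]
    ring
  simp only [e]
  rw [integral_const_mul]
  split_ifs with hij
  · subst hij
    have h1 := normSq_pos h hΨ m i
    rw [← sq (derivative^[m] (Ψ (m + i)))]
    change (((_ * normSq k α β Ψ (m + i) m : ℝ)) : ℂ) = 1
    rw [assocNorm_eq, ← mul_inv, Real.mul_self_sqrt h1.le, inv_mul_cancel₀ h1.ne',
      Complex.ofReal_one]
  · rw [integral_mul_eq_zero h hΨ (by omega)]
    simp

/-- This is the action of the lowering operator: the factor √(λ_{m+n+1} - λ_m) is the ratio of the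
norms of Ψ_{l,m+1} and Ψ_{l,m} for l = m + n + 1. -/
theorem derivative_normPoly_succ (h : Admissible k α β)
    (hΨ : ∀ l, IsPolynomialSolution k α β l (Ψ l)) (m n : ℕ) :
    derivative (normPoly k α β Ψ (m + (n + 1)) m) =
      C (√(gap k α m (n + 1))) * normPoly k α β Ψ (m + (n + 1)) (m + 1) := by
  have h1 := normSq_succ h hΨ (m + (n + 1)) m
  rw [lam_sub_lam] at h1
  have h2 : assocNorm k α β Ψ (m + (n + 1)) (m + 1) =
      √(gap k α m (n + 1)) * assocNorm k α β Ψ (m + (n + 1)) m := by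
    rw [assocNorm_eq, assocNorm_eq, h1, Real.sqrt_mul (gap_pos h m n).le]
  have h3 : √(gap k α m (n + 1)) ≠ 0 := (Real.sqrt_pos.2 (gap_pos h m n)).ne'
  rw [normPoly, normPoly, h2, derivative_C_mul, Function.iterate_succ_apply', ← mul_assoc, ← C_mul,
    mul_inv, mul_inv_cancel_left₀ h3]

theorem derivative_normPoly_zero (h : Admissible k α β)
    (hΨ : ∀ l, IsPolynomialSolution k α β l (Ψ l)) (m : ℕ) :
    derivative (normPoly k α β Ψ m m) = 0 := by
  have h1 : (derivative^[m] (Ψ m)).degree = 0 := by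
    simpa using degree_iterate_derivative h hΨ m 0
  rw [normPoly, derivative_C_mul, eq_C_of_degree_le_zero h1.le, derivative_C, mul_zero]

end Inner

/-! ### Completeness of the |n⟩ and the unitary shift. -/

section Complete

variable {k : Kind} {α β : ℝ} {Ψ : ℕ → ℝ[X]}

theorem integrable_polyFun_mul_exp_mul {t : ℝ}
    (ht : 2 * t ∈ interior (ProbabilityTheory.integrableExpSet id (wMeasure k α β))) (m : ℕ)
    (P : ℝ[X]) (f : Hil k α β) :
    Integrable (fun s => polyFun k m P s * (Real.exp (t * s) : ℝ) * f s) (wMeasure k α β) :=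
  (memLp_polyFun_mul_exp ht m P).integrable_mul (Lp.memLp f)

theorem inner_polyVec_left (h : Admissible k α β) (m : ℕ) (f : Hil k α β) (P : ℝ[X]) :
    ⟪polyVec k α β m P, f⟫_ℂ = ∫ s, polyFun k m P s * f s ∂(wMeasure k α β) := by
  rw [L2.inner_def]
  refine integral_congr_ae ?_
  filter_upwards [coeFn_polyVec h m P] with s hs
  rw [hs, RCLike.inner_apply, polyFun, Complex.conj_ofReal, mul_comm]

/-- A function orthogonal to all `κ ^ m P`, `P` a polynomial, vanishes. -/
theorem eq_zero_of_inner_polyVec (h : Admissible k α β) (m : ℕ) (f : Hil k α β)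
    (hf : ∀ P, ⟪polyVec k α β m P, f⟫_ℂ = 0) : f = 0 := by
  obtain ⟨ε, hε, H⟩ := mem_interior_integrableExpSet h
  have hint : ∀ P t, |t| < ε / 2 →
      Integrable (fun s => polyFun k m P s * (Real.exp (t * s) : ℝ) * f s) (wMeasure k α β) :=
    fun P t ht => integrable_polyFun_mul_exp_mul
      (H _ (by rw [abs_mul, abs_two]; linarith)) m P f
  have hint0 : ∀ P, Integrable (fun s => polyFun k m P s * f s) (wMeasure k α β) := fun P => by
    simpa using hint P 0 (by simpa using half_pos hε)
  have hzero : ∀ P, ∫ s, polyFun k m P s * f s ∂(wMeasure k α β) = 0 := by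
    intro P
    rw [← hf P, inner_polyVec_left h]
  have hm : Measurable f := (Lp.stronglyMeasurable f).measurable
  have hκ := (continuous_kappa k).measurable
  -- The moment argument is for real functions, so it is applied to κ^m times the real and the
  -- imaginary part of f; κ has no zero in the interval.
  have key : ∀ L : ℂ →L[ℝ] ℝ, (fun s => kappa k s ^ m * L (f s)) =ᵐ[wMeasure k α β] 0 := by
    intro L
    have hL : ∀ (r : ℝ) (z : ℂ), L ((r : ℂ) * z) = r * L z := fun r z => by
      rw [← Complex.real_smul, map_smul, smul_eq_mul]
    have hLm : Measurable fun s => L (f s) := L.continuous.measurable.comp hm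
    refine ae_eq_zero_of_moments (ε := ε / 2) (by fun_prop) (half_pos hε) (fun t ht => ?_)
      (fun n => ?_) (fun n => ?_)
    · refine (L.integrable_comp (hint 1 t ht)).congr (ae_of_all _ fun s => ?_)
      dsimp only
      rw [polyFun, ← Complex.ofReal_mul, hL]
      simp only [eval_one]
      ring
    · have := L.integral_comp_comm (hint0 (X ^ n))
      rw [hzero, map_zero] at this
      rw [← this]
      refine integral_congr_ae (ae_of_all _ fun s => ?_)
      dsimp only
      rw [polyFun, hL]
      simp only [eval_pow, eval_X]
      ring
    · refine (L.integrable_comp (hint0 (X ^ n))).congr (ae_of_all _ fun s => ?_)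
      dsimp only
      rw [polyFun, hL]
      simp only [eval_pow, eval_X]
      ring
  rw [Lp.eq_zero_iff_ae_eq_zero]
  filter_upwards [key Complex.reCLM, key Complex.imCLM, ae_mem_interval k α β] with s h1 h2 hs
  have h0 := (pow_pos (kappa_pos hs) m).ne'
  apply Complex.ext
  · simpa [h0] using h1
  · simpa [h0] using h2

theorem span_normPoly (h : Admissible k α β) (hΨ : ∀ l, IsPolynomialSolution k α β l (Ψ l))
    (m : ℕ) : Submodule.span ℝ (Set.range fun n => normPoly k α β Ψ (m + n) m) = ⊤ := by
  have hdeg : ∀ n, (normPoly k α β Ψ (m + n) m).degree = n := fun n => by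
    rw [normPoly, degree_C_mul, degree_iterate_derivative h hΨ]
    rw [assocNorm_eq]
    exact inv_ne_zero (Real.sqrt_pos.2 (normSq_pos h hΨ m n)).ne'
  let S : Polynomial.Sequence ℝ := ⟨fun n => normPoly k α β Ψ (m + n) m, hdeg⟩
  exact S.span fun i => (leadingCoeff_ne_zero.2 (S.ne_zero i)).isUnit

theorem polyVec_add (h : Admissible k α β) (m : ℕ) (P Q : ℝ[X]) :
    polyVec k α β m (P + Q) = polyVec k α β m P + polyVec k α β m Q := by
  refine Lp.ext ?_
  filter_upwards [coeFn_polyVec h m P, coeFn_polyVec h m Q, coeFn_polyVec h m (P + Q),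
    Lp.coeFn_add (polyVec k α β m P) (polyVec k α β m Q)] with s h1 h2 h3 h4
  rw [h4, h3, Pi.add_apply, h1, h2]
  simp only [polyFun, eval_add]
  push_cast
  ring

theorem polyVec_smul (h : Admissible k α β) (m : ℕ) (c : ℝ) (P : ℝ[X]) :
    polyVec k α β m (c • P) = (c : ℂ) • polyVec k α β m P := by
  refine Lp.ext ?_
  filter_upwards [coeFn_polyVec h m P, coeFn_polyVec h m (c • P),
    Lp.coeFn_smul (c : ℂ) (polyVec k α β m P)] with s h1 h2 h3
  rw [h3, h2, Pi.smul_apply, h1]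
  simp only [polyFun, eval_smul, smul_eq_mul]
  push_cast
  ring

theorem orthogonal_span_ket (h : Admissible k α β)
    (hΨ : ∀ l, IsPolynomialSolution k α β l (Ψ l)) (m : ℕ) :
    (Submodule.span ℂ (Set.range (ket k α β Ψ m)))ᗮ = ⊥ := by
  rw [Submodule.eq_bot_iff]
  intro f hf
  refine eq_zero_of_inner_polyVec h m f fun P => ?_
  have hP : P ∈ Submodule.span ℝ (Set.range fun n => normPoly k α β Ψ (m + n) m) := by
    rw [span_normPoly h hΨ]; trivial
  induction hP using Submodule.span_induction with
  | mem x hx =>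
    obtain ⟨n, rfl⟩ := hx
    rw [← normAssoc_eq]
    exact (Submodule.mem_orthogonal _ _).1 hf _ (Submodule.subset_span ⟨n, rfl⟩)
  | zero =>
    have := polyVec_smul h m 0 0
    rw [zero_smul, Complex.ofReal_zero, zero_smul] at this
    rw [this, inner_zero_left]
  | add P Q _ _ hP hQ => rw [polyVec_add h, inner_add_left, hP, hQ, add_zero]
  | smul c P _ hP => rw [polyVec_smul h, inner_smul_left, hP, mul_zero]

/-- The vectors `|n⟩` form a Hilbert basis. -/
def ketBasis (h : Admissible k α β) (hΨ : ∀ l, IsPolynomialSolution k α β l (Ψ l)) (m : ℕ) :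
    HilbertBasis ℕ ℂ (Hil k α β) :=
  HilbertBasis.mkOfOrthogonalEqBot (orthonormal_ket h hΨ m) (orthogonal_span_ket h hΨ m)

theorem ketBasis_apply (h : Admissible k α β) (hΨ : ∀ l, IsPolynomialSolution k α β l (Ψ l))
    (m n : ℕ) : ketBasis h hΨ m n = ket k α β Ψ m n := by
  rw [ketBasis, HilbertBasis.coe_mkOfOrthogonalEqBot]

theorem isShift_iff {m : ℕ} (U : Hil k α β ≃ₗᵢ[ℂ] Hil k α β) :
    IsShift k α β Ψ m U ↔ ∀ n, U (ket k α β Ψ m n) = ket k α β Ψ (m + 1) n := by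
  constructor
  · intro hU n
    rw [ket, hU _ (Nat.le_add_right m n), ket, Nat.add_right_comm]
  · intro hU l hl
    obtain ⟨n, rfl⟩ := Nat.exists_eq_add_of_le hl
    have := hU n
    rw [ket, ket] at this
    rw [this, Nat.add_right_comm]

/-- Existence: pass to coordinates in one Hilbert basis and back through the other. Uniqueness: a
continuous linear map is determined by its values on a Hilbert basis. -/
theorem existsUnique_isShift (h : Admissible k α β)
    (hΨ : ∀ l, IsPolynomialSolution k α β l (Ψ l)) (m : ℕ) :
    ∃! U : Hil k α β ≃ₗᵢ[ℂ] Hil k α β, IsShift k α β Ψ m U := by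
  refine ⟨(ketBasis h hΨ m).repr.trans (ketBasis h hΨ (m + 1)).repr.symm, ?_, ?_⟩
  · refine (isShift_iff _).2 fun n => ?_
    rw [← ketBasis_apply h hΨ, ← ketBasis_apply h hΨ, LinearIsometryEquiv.trans_apply,
      HilbertBasis.repr_self, HilbertBasis.repr_symm_single]
  · intro U hU
    rw [isShift_iff] at hU
    ext1 f
    have h1 := ((ketBasis h hΨ m).hasSum_repr f).mapL (U : Hil k α β →L[ℂ] Hil k α β)
    have h2 := (ketBasis h hΨ (m + 1)).hasSum_repr_symm ((ketBasis h hΨ m).repr f)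
    rw [LinearIsometryEquiv.trans_apply]
    refine h1.unique ?_
    convert! h2 using 1
    ext1 n
    rw [ketBasis_apply, ketBasis_apply, ← hU n]
    simp

end Complete

/-! ### Local pointwise bounds for the normalized polynomials. -/

section PointwiseBounds

variable {k : Kind} {α β : ℝ} {Ψ : ℕ → ℝ[X]}

/-- One-dimensional Sobolev inequality: P(s)² - P(t)² = ∫ 2PP' is at most ∫ (P² + P'²) over the
whole interval, and this is averaged over t. -/
theorem sq_eval_le_integral (P : ℝ[X]) {c d s : ℝ} (hcd : c < d) (hs : s ∈ Set.Icc c d) :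
    (d - c) * P.eval s ^ 2 ≤
      (1 + (d - c)) * ∫ t in c..d, (P.eval t ^ 2 + (derivative P).eval t ^ 2) := by
  have hi : ∀ {f : ℝ → ℝ} (a b : ℝ), Continuous f → IntervalIntegrable f volume a b :=
    fun a b hf => hf.intervalIntegrable a b
  have hP := P.continuous
  have hP' := (derivative P).continuous
  set J := ∫ t in c..d, (P.eval t ^ 2 + (derivative P).eval t ^ 2) with hJ
  have h1 : ∀ t ∈ Set.Icc c d, P.eval s ^ 2 ≤ P.eval t ^ 2 + J := by
    intro t ht
    have hft : ∫ x in t..s, 2 * P.eval x * (derivative P).eval x = P.eval s ^ 2 - P.eval t ^ 2 := by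
      refine intervalIntegral.integral_eq_sub_of_hasDerivAt (f := fun x => P.eval x ^ 2)
        (fun x _ => ?_) (hi _ _ (by fun_prop))
      exact ((P.hasDerivAt x).pow 2).congr_deriv (by simp)
    have hle : |∫ x in t..s, 2 * P.eval x * (derivative P).eval x| ≤ J := by
      refine (intervalIntegral.norm_integral_le_integral_norm_uIoc
        (f := fun x => 2 * P.eval x * (derivative P).eval x) (μ := volume)).trans ?_
      simp only [Real.norm_eq_abs]
      rw [hJ, intervalIntegral.integral_of_le hcd.le]
      have hsub : Set.uIoc t s ⊆ Set.Ioc c d := by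
        intro x hx
        rw [Set.mem_uIoc] at hx
        rcases hx with hx | hx
        · exact ⟨lt_of_le_of_lt ht.1 hx.1, hx.2.trans hs.2⟩
        · exact ⟨lt_of_le_of_lt hs.1 hx.1, hx.2.trans ht.2⟩
      have hint : IntegrableOn (fun x => |2 * P.eval x * (derivative P).eval x|) (Set.Ioc c d) :=
        (intervalIntegrable_iff_integrableOn_Ioc_of_le hcd.le).1 (hi _ _ (by fun_prop))
      refine (setIntegral_mono_set hint (ae_of_all _ fun _ => abs_nonneg _)
        (LE.le.eventuallyLE hsub)).trans (setIntegral_mono hint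
        ((intervalIntegrable_iff_integrableOn_Ioc_of_le hcd.le).1 (hi _ _ (by fun_prop))) ?_)
      intro x
      dsimp only
      rw [abs_le]
      constructor <;>
        nlinarith [sq_nonneg (P.eval x - (derivative P).eval x),
          sq_nonneg (P.eval x + (derivative P).eval x)]
    rw [hft] at hle
    linarith [(abs_le.1 hle).2]
  have h2 : ∫ _t in c..d, P.eval s ^ 2 ≤ ∫ t in c..d, (P.eval t ^ 2 + J) :=
    intervalIntegral.integral_mono_on hcd.le (hi _ _ (by fun_prop)) (hi _ _ (by fun_prop)) h1
  rw [intervalIntegral.integral_const, smul_eq_mul,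
    intervalIntegral.integral_add (hi _ _ (by fun_prop)) (hi _ _ (by fun_prop)),
    intervalIntegral.integral_const, smul_eq_mul] at h2
  have h3 : ∫ t in c..d, P.eval t ^ 2 ≤ J :=
    intervalIntegral.integral_mono_on hcd.le (hi _ _ (by fun_prop)) (hi _ _ (by fun_prop))
      fun t _ => by nlinarith [sq_nonneg ((derivative P).eval t)]
  linarith

theorem continuousOn_weight (k : Kind) (α β : ℝ) :
    ContinuousOn (weight k α β) (interval k) := by
  cases k
  · exact Continuous.continuousOn (by unfold weight; fun_prop)
  · intro s hs
    exact ((Real.continuousAt_rpow_const _ _ (Or.inl (ne_of_gt hs))).mul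
      (Continuous.continuousAt (by fun_prop))).continuousWithinAt
  · intro s hs
    have hs1 : 0 < 1 + s := by linarith [hs.1]
    have hs2 : 0 < 1 - s := by linarith [hs.2]
    exact (((continuousAt_const.add continuousAt_id).rpow_const (Or.inl hs1.ne')).mul
      ((continuousAt_const.sub continuousAt_id).rpow_const (Or.inl hs2.ne'))).continuousWithinAt

/-- On a compact part of the interval the weight σ^m ϱ has a positive minimum; M is its inverse. -/
theorem exists_intervalIntegral_sq_le (h : Admissible k α β) (m : ℕ) {c d : ℝ} (hcd : c ≤ d)
    (hK : Set.Icc c d ⊆ interval k) : ∃ M, 0 < M ∧ ∀ P : ℝ[X],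
      ∫ t in c..d, P.eval t ^ 2 ≤ M * ∫ s, (sigma k ^ m * P ^ 2).eval s ∂(wMeasure k α β) := by
  have hc : ContinuousOn (fun s => (sigma k).eval s ^ m * weight k α β s) (Set.Icc c d) :=
    (Continuous.continuousOn (by fun_prop)).mul ((continuousOn_weight k α β).mono hK)
  obtain ⟨s₀, hs₀, hmin⟩ := isCompact_Icc.exists_isMinOn (Set.nonempty_Icc.2 hcd) hc
  have hpos : ∀ s ∈ interval k, 0 < (sigma k).eval s ^ m * weight k α β s := fun s hs =>
    mul_pos (pow_pos (sigma_eval_pos hs) m) (weight_pos k α β hs)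
  set δ := (sigma k).eval s₀ ^ m * weight k α β s₀ with hδ
  have hδ0 : 0 < δ := hpos s₀ (hK hs₀)
  refine ⟨δ⁻¹, inv_pos.2 hδ0, fun P => ?_⟩
  have hint := integrable_wMeasure_iff.1 (integrable_eval h (sigma k ^ m * P ^ 2))
  rw [← div_eq_inv_mul, le_div_iff₀ hδ0, integral_wMeasure,
    intervalIntegral.integral_of_le hcd, ← integral_mul_const, ← integral_Icc_eq_integral_Ioc]
  have e : ∀ s, weight k α β s • (sigma k ^ m * P ^ 2).eval s =
      P.eval s ^ 2 * ((sigma k).eval s ^ m * weight k α β s) := fun s => by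
    simp only [eval_mul, eval_pow, smul_eq_mul]; ring
  simp only [e] at hint ⊢
  refine (setIntegral_mono_on ?_ (hint.mono_set hK) measurableSet_Icc fun s hs => ?_).trans
    (setIntegral_mono_set hint ?_ (LE.le.eventuallyLE hK))
  · exact (Continuous.continuousOn (by fun_prop)).integrableOn_Icc
  · exact mul_le_mul_of_nonneg_left (hmin hs) (sq_nonneg _)
  · filter_upwards [ae_restrict_mem (isOpen_interval k).measurableSet] with s hs
    exact mul_nonneg (sq_nonneg _) (hpos s hs).le

/-- The derivative is measured with one more power of σ because both integrals are then known for
the normalized polynomials: they are 1 and `gap`. -/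
theorem exists_sq_eval_le (h : Admissible k α β) (m : ℕ) {c d : ℝ} (hcd : c < d)
    (hK : Set.Icc c d ⊆ interval k) : ∃ M, 0 < M ∧ ∀ P : ℝ[X], ∀ s ∈ Set.Icc c d,
      P.eval s ^ 2 ≤ M * (∫ s, (sigma k ^ m * P ^ 2).eval s ∂(wMeasure k α β) +
        ∫ s, (sigma k ^ (m + 1) * derivative P ^ 2).eval s ∂(wMeasure k α β)) := by
  obtain ⟨M₁, hM₁, H₁⟩ := exists_intervalIntegral_sq_le h m hcd.le hK
  obtain ⟨M₂, hM₂, H₂⟩ := exists_intervalIntegral_sq_le h (m + 1) hcd.le hK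
  have hdc : 0 < d - c := sub_pos.2 hcd
  refine ⟨(1 + (d - c)) / (d - c) * (M₁ + M₂), by positivity, fun P s hs => ?_⟩
  have hnn : ∀ (j : ℕ) (Q : ℝ[X]), 0 ≤ ∫ s, (sigma k ^ j * Q ^ 2).eval s ∂(wMeasure k α β) := by
    intro j Q
    refine integral_nonneg_of_ae ?_
    filter_upwards [ae_mem_interval k α β] with s hs
    have := sigma_eval_pos hs
    simp only [eval_mul, eval_pow, Pi.zero_apply]
    positivity
  have h0 := sq_eval_le_integral P hcd hs
  rw [intervalIntegral.integral_add (Continuous.intervalIntegrable (by fun_prop) _ _)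
    (Continuous.intervalIntegrable (by fun_prop) _ _)] at h0
  have h1 := H₁ P
  have h2 := H₂ (derivative P)
  have n1 := hnn m P
  have n2 := hnn (m + 1) (derivative P)
  rw [div_mul_eq_mul_div, div_mul_eq_mul_div, le_div_iff₀ hdc, mul_comm, mul_assoc]
  refine h0.trans (mul_le_mul_of_nonneg_left ?_ (by positivity))
  nlinarith [mul_nonneg hM₁.le n2, mul_nonneg hM₂.le n1]

theorem integral_normPoly_sq (h : Admissible k α β)
    (hΨ : ∀ l, IsPolynomialSolution k α β l (Ψ l)) (m n : ℕ) :
    ∫ s, (sigma k ^ m * normPoly k α β Ψ (m + n) m ^ 2).eval s ∂(wMeasure k α β) = 1 := by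
  have h1 := (orthonormal_iff_ite.1 (orthonormal_ket h hΨ m)) n n
  rw [ket, normAssoc_eq, inner_polyVec h, if_pos rfl, ← sq] at h1
  exact_mod_cast h1

theorem gap_nonneg (h : Admissible k α β) (m n : ℕ) : 0 ≤ gap k α m n := by
  cases n with
  | zero => rw [gap_zero]
  | succ n => exact (gap_pos h m n).le

theorem integral_derivative_normPoly_sq (h : Admissible k α β)
    (hΨ : ∀ l, IsPolynomialSolution k α β l (Ψ l)) (m n : ℕ) :
    ∫ s, (sigma k ^ (m + 1) * derivative (normPoly k α β Ψ (m + n) m) ^ 2).eval s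
      ∂(wMeasure k α β) = gap k α m n := by
  cases n with
  | zero => simp [derivative_normPoly_zero h hΨ, gap_zero]
  | succ n =>
    have h1 := integral_normPoly_sq h hΨ (m + 1) n
    rw [Nat.add_right_comm, Nat.add_assoc] at h1
    have e : ∀ s, (sigma k ^ (m + 1) * derivative (normPoly k α β Ψ (m + (n + 1)) m) ^ 2).eval s =
        gap k α m (n + 1) *
          (sigma k ^ (m + 1) * normPoly k α β Ψ (m + (n + 1)) (m + 1) ^ 2).eval s := by
      intro s
      rw [derivative_normPoly_succ h hΨ, mul_pow, ← C_pow, Real.sq_sqrt (gap_nonneg h m _)]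
      simp only [eval_mul, eval_C]
      ring
    simp only [e]
    rw [integral_const_mul, h1, mul_one]

theorem gap_succ_le (h : Admissible k α β) (m n : ℕ) :
    gap k α (m + 1) n ≤ gap k α m (n + 1) := by
  have h1 := lam_sub_lam k α β (m + 1) n
  have h2 := lam_sub_lam k α β m (n + 1)
  have h3 := lam_strictMono h (Nat.lt_succ_self m)
  rw [Nat.add_right_comm, Nat.add_assoc] at h1
  simp only [Nat.succ_eq_add_one] at h3
  linarith

/-- What matters is that the bound is polynomial in n, so that the factorial decay of the
coefficients of a coherent state absorbs it. The Sobolev bound is √(1 + gap), weakened to 1 + gap.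
-/
theorem exists_abs_normPoly_le (h : Admissible k α β)
    (hΨ : ∀ l, IsPolynomialSolution k α β l (Ψ l)) (m : ℕ) {c d : ℝ} (hcd : c < d)
    (hK : Set.Icc c d ⊆ interval k) : ∃ M, 0 < M ∧ ∀ n, ∀ s ∈ Set.Icc c d,
      |(normPoly k α β Ψ (m + n) m).eval s| ≤ M * (1 + gap k α m n) := by
  obtain ⟨M, hM, H⟩ := exists_sq_eval_le h m hcd hK
  refine ⟨√M, Real.sqrt_pos.2 hM, fun n s hs => ?_⟩
  have h1 := H (normPoly k α β Ψ (m + n) m) s hs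
  rw [integral_normPoly_sq h hΨ, integral_derivative_normPoly_sq h hΨ] at h1
  have hg := gap_nonneg h m n
  refine abs_le_of_sq_le_sq ?_ (by positivity)
  rw [mul_pow, Real.sq_sqrt hM.le]
  refine h1.trans (mul_le_mul_of_nonneg_left ?_ hM.le)
  nlinarith

/-- The derivative is √gap times a normalized polynomial of level m + 1, to which the Sobolev bound
of that level applies. -/
theorem exists_abs_derivative_normPoly_le (h : Admissible k α β)
    (hΨ : ∀ l, IsPolynomialSolution k α β l (Ψ l)) (m : ℕ) {c d : ℝ} (hcd : c < d)
    (hK : Set.Icc c d ⊆ interval k) : ∃ M, 0 < M ∧ ∀ n, ∀ s ∈ Set.Icc c d,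
      |(derivative (normPoly k α β Ψ (m + n) m)).eval s| ≤ M * (1 + gap k α m n) := by
  obtain ⟨M, hM, H⟩ := exists_sq_eval_le h (m + 1) hcd hK
  refine ⟨√M, Real.sqrt_pos.2 hM, fun n s hs => ?_⟩
  have hg := gap_nonneg h m n
  cases n with
  | zero =>
    rw [Nat.add_zero, derivative_normPoly_zero h hΨ, eval_zero, abs_zero]
    positivity
  | succ n =>
    have h1 := H (normPoly k α β Ψ (m + 1 + n) (m + 1)) s hs
    rw [integral_normPoly_sq h hΨ, integral_derivative_normPoly_sq h hΨ, Nat.add_right_comm,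
      Nat.add_assoc] at h1
    have h2 := gap_succ_le h m n
    have h3 := gap_nonneg h (m + 1) n
    refine abs_le_of_sq_le_sq ?_ (by positivity)
    rw [derivative_normPoly_succ h hΨ, eval_mul, eval_C, mul_pow, Real.sq_sqrt hg, mul_pow,
      Real.sq_sqrt hM.le]
    calc _ ≤ gap k α m (n + 1) * (M * (1 + gap k α (m + 1) n)) := by gcongr
      _ ≤ gap k α m (n + 1) * (M * (1 + gap k α m (n + 1))) := by gcongr
      _ = M * (gap k α m (n + 1) * (1 + gap k α m (n + 1))) := by ring
      _ ≤ _ := mul_le_mul_of_nonneg_left (by nlinarith) hM.le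

end PointwiseBounds

/-! ### Identification of an L² sum with a pointwise sum. -/

section LpSeries

/-- Some subsequence of the partial sums converges almost everywhere to the L² limit, and the
pointwise sum is the only possible limit. -/
theorem ae_eq_of_hasSum_Lp {X : Type*} [MeasurableSpace X] {μ : Measure X} {v : ℕ → Lp ℂ 2 μ}
    {f : Lp ℂ 2 μ} {u : ℕ → X → ℂ} {F : X → ℂ} (hf : HasSum v f) (hv : ∀ n, v n =ᵐ[μ] u n)
    (hF : ∀ᵐ x ∂μ, HasSum (fun n => u n x) (F x)) : f =ᵐ[μ] F := by
  obtain ⟨ns, hns, h1⟩ :=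
    (tendstoInMeasure_of_tendsto_Lp hf.tendsto_sum_nat).exists_seq_tendsto_ae
  have h2 : ∀ N, (∑ i ∈ Finset.range N, v i : Lp ℂ 2 μ) =ᵐ[μ]
      fun x => ∑ i ∈ Finset.range N, u i x := by
    intro N
    induction N with
    | zero =>
      rw [Finset.sum_range_zero]
      simp only [Finset.range_zero, Finset.sum_empty]
      exact Lp.coeFn_zero ℂ 2 μ
    | succ N ih =>
      rw [Finset.sum_range_succ]
      filter_upwards [ih, hv N, Lp.coeFn_add (∑ i ∈ Finset.range N, v i) (v N)] with x h1 h2 h3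
      rw [h3, Pi.add_apply, h1, h2, Finset.sum_range_succ]
  filter_upwards [h1, hF, ae_all_iff.2 h2] with x hx1 hx2 hx3
  simp only [hx3] at hx1
  exact tendsto_nhds_unique hx1 (hx2.tendsto_sum_nat.comp hns.tendsto_atTop)

end LpSeries

/-! ### Termwise action of A_m and eigenvectors of a_m. -/

section Eigen

variable {k : Kind} {α β : ℝ} {Ψ : ℕ → ℝ[X]}

theorem hasDerivAt_series (h : Admissible k α β) (hΨ : ∀ l, IsPolynomialSolution k α β l (Ψ l))
    (m : ℕ) {c : ℕ → ℂ} (hc : Summable fun n => ‖c n‖ * (1 + gap k α m n)) {s : ℝ}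
    (hs : s ∈ interval k) :
    Summable (fun n => c n * ((normPoly k α β Ψ (m + n) m).eval s : ℝ)) ∧
    Summable (fun n => c n * ((derivative (normPoly k α β Ψ (m + n) m)).eval s : ℝ)) ∧
    HasDerivAt (fun s : ℝ => ∑' n, c n * ((normPoly k α β Ψ (m + n) m).eval s : ℝ))
      (∑' n, c n * ((derivative (normPoly k α β Ψ (m + n) m)).eval s : ℝ)) s := by
  obtain ⟨ε, hε, hK⟩ := Metric.nhds_basis_closedBall.mem_iff.1 ((isOpen_interval k).mem_nhds hs)
  rw [Real.closedBall_eq_Icc] at hK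
  have hcd : s - ε < s + ε := by linarith
  have hs' : s ∈ Set.Ioo (s - ε) (s + ε) := ⟨by linarith, by linarith⟩
  obtain ⟨M₁, -, H₁⟩ := exists_abs_normPoly_le h hΨ m hcd hK
  obtain ⟨M₂, -, H₂⟩ := exists_abs_derivative_normPoly_le h hΨ m hcd hK
  have b₁ : ∀ n, ∀ x ∈ Set.Ioo (s - ε) (s + ε), ‖c n * ((normPoly k α β Ψ (m + n) m).eval x : ℝ)‖ ≤
      M₁ * (‖c n‖ * (1 + gap k α m n)) := by
    intro n x hx
    rw [norm_mul, Complex.norm_real, Real.norm_eq_abs]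
    calc _ ≤ ‖c n‖ * (M₁ * (1 + gap k α m n)) := by
          gcongr; exact H₁ n x (Set.Ioo_subset_Icc_self hx)
      _ = _ := by ring
  have b₂ : ∀ n, ∀ x ∈ Set.Ioo (s - ε) (s + ε),
      ‖c n * ((derivative (normPoly k α β Ψ (m + n) m)).eval x : ℝ)‖ ≤
      M₂ * (‖c n‖ * (1 + gap k α m n)) := by
    intro n x hx
    rw [norm_mul, Complex.norm_real, Real.norm_eq_abs]
    calc _ ≤ ‖c n‖ * (M₂ * (1 + gap k α m n)) := by
          gcongr; exact H₂ n x (Set.Ioo_subset_Icc_self hx)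
      _ = _ := by ring
  have s₁ : Summable (fun n => c n * ((normPoly k α β Ψ (m + n) m).eval s : ℝ)) :=
    Summable.of_norm_bounded (hc.mul_left M₁) fun n => b₁ n s hs'
  refine ⟨s₁, Summable.of_norm_bounded (hc.mul_left M₂) fun n => b₂ n s hs', ?_⟩
  exact hasDerivAt_tsum_of_isPreconnected (hc.mul_left M₂) isOpen_Ioo isPreconnected_Ioo
    (fun n x _ => ((normPoly k α β Ψ (m + n) m).hasDerivAt x).ofReal_comp.const_mul (c n))
    b₂ hs' s₁ hs'

theorem hasDerivAt_kappa {s : ℝ} (hs : s ∈ interval k) :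
    HasDerivAt (kappa k) (deriv (kappa k) s) s := by
  have : DifferentiableAt ℝ (kappa k) s :=
    (sigma k).differentiable.differentiableAt.sqrt (sigma_eval_pos hs).ne'
  exact this.hasDerivAt

/-- The term -mκ' in A_m cancels exactly the derivative of the factor κ^m. -/
theorem diffExpr_kappa_pow_mul (m : ℕ) {s : ℝ} (hs : s ∈ interval k) {G : ℝ → ℂ} {G' : ℂ}
    (hG : HasDerivAt G G' s) :
    HasDerivAt (fun s => ((kappa k s ^ m : ℝ) : ℂ) * G s)
      (((m * kappa k s ^ (m - 1) * deriv (kappa k) s : ℝ) : ℂ) * G s +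
        ((kappa k s ^ m : ℝ) : ℂ) * G') s ∧
    diffExpr k m (fun s => ((kappa k s ^ m : ℝ) : ℂ) * G s) s =
      ((kappa k s ^ (m + 1) : ℝ) : ℂ) * G' := by
  have h1 : HasDerivAt (fun s => ((kappa k s ^ m : ℝ) : ℂ))
      ((m * kappa k s ^ (m - 1) * deriv (kappa k) s : ℝ) : ℂ) s :=
    ((hasDerivAt_kappa hs).pow m).ofReal_comp
  have h2 := h1.mul hG
  refine ⟨h2, ?_⟩
  have h3 : deriv (fun s => ((kappa k s ^ m : ℝ) : ℂ) * G s) s = _ := h2.deriv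
  rw [diffExpr, h3]
  -- For m = 0 the exponent m - 1 is truncated to 0, harmlessly, since the factor m vanishes.
  cases m with
  | zero => simp
  | succ m =>
    push_cast
    ring

theorem norm_ket (h : Admissible k α β) (hΨ : ∀ l, IsPolynomialSolution k α β l (Ψ l)) (m n : ℕ) :
    ‖ket k α β Ψ m n‖ = 1 :=
  (orthonormal_ket h hΨ m).1 n

theorem summable_norm_of_summable_mul_gap (h : Admissible k α β) (m : ℕ) {c : ℕ → ℂ}
    (hc : Summable fun n => ‖c n‖ * (1 + gap k α m n)) : Summable fun n => ‖c n‖ :=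
  Summable.of_nonneg_of_le (fun _ => norm_nonneg _) (fun n =>
    le_mul_of_one_le_right (norm_nonneg _) (by linarith [gap_nonneg h m n])) hc

theorem summable_smul_ket (h : Admissible k α β)
    (hΨ : ∀ l, IsPolynomialSolution k α β l (Ψ l)) (m : ℕ) {c : ℕ → ℂ}
    (hc : Summable fun n => ‖c n‖) : Summable fun n => c n • ket k α β Ψ m n := by
  refine Summable.of_norm ?_
  simpa [norm_smul, norm_ket h hΨ] using hc

/-- The sum of a rapidly convergent series in the vectors `|n⟩` has a differentiable
representative, and `A_m` can be applied term by term. -/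
theorem exists_isGoodRep_tsum (h : Admissible k α β)
    (hΨ : ∀ l, IsPolynomialSolution k α β l (Ψ l)) (m : ℕ) {c : ℕ → ℂ}
    (hc : Summable fun n => ‖c n‖ * (1 + gap k α m n))
    (hc' : Summable fun n => ‖c (n + 1) * (√(gap k α m (n + 1)) : ℝ)‖) :
    ∃ F, IsGoodRep k α β m (∑' n, c n • ket k α β Ψ m n) F ∧
      diffExpr k m F =ᵐ[wMeasure k α β]
        (∑' n, (c (n + 1) * (√(gap k α m (n + 1)) : ℝ)) • ket k α β Ψ (m + 1) n : Hil k α β) := by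
  set G : ℝ → ℂ := fun s => ∑' n, c n * ((normPoly k α β Ψ (m + n) m).eval s : ℝ) with hG
  set F : ℝ → ℂ := fun s => ((kappa k s ^ m : ℝ) : ℂ) * G s with hF
  have hsum : HasSum (fun n => c n • ket k α β Ψ m n) (∑' n, c n • ket k α β Ψ m n) :=
    (summable_smul_ket h hΨ m (summable_norm_of_summable_mul_gap h m hc)).hasSum
  have hsum' : HasSum (fun n => (c (n + 1) * (√(gap k α m (n + 1)) : ℝ)) • ket k α β Ψ (m + 1) n)
      (∑' n, (c (n + 1) * (√(gap k α m (n + 1)) : ℝ)) • ket k α β Ψ (m + 1) n) :=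
    (summable_smul_ket h hΨ (m + 1) hc').hasSum
  have hcoe : ∀ (a : ℂ) (j n : ℕ), (a • ket k α β Ψ j n : Hil k α β) =ᵐ[wMeasure k α β]
      fun s => a * polyFun k j (normPoly k α β Ψ (j + n) j) s := by
    intro a j n
    rw [ket, normAssoc_eq]
    filter_upwards [Lp.coeFn_smul a (polyVec k α β j (normPoly k α β Ψ (j + n) j)),
      coeFn_polyVec h j (normPoly k α β Ψ (j + n) j)] with s h1 h2
    rw [h1, Pi.smul_apply, h2, smul_eq_mul]
  have hae : (∑' n, c n • ket k α β Ψ m n : Hil k α β) =ᵐ[wMeasure k α β] F := by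
    refine ae_eq_of_hasSum_Lp hsum (fun n => hcoe (c n) m n) ?_
    filter_upwards [ae_mem_interval k α β] with s hs
    have := (hasDerivAt_series h hΨ m hc hs).1.hasSum.mul_left ((kappa k s ^ m : ℝ) : ℂ)
    refine this.congr_fun fun n => ?_
    simp only [polyFun]
    push_cast
    ring
  have hae' : (∑' n, (c (n + 1) * (√(gap k α m (n + 1)) : ℝ)) • ket k α β Ψ (m + 1) n :
      Hil k α β) =ᵐ[wMeasure k α β] diffExpr k m F := by
    refine ae_eq_of_hasSum_Lp hsum' (fun n => hcoe _ (m + 1) n) ?_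
    filter_upwards [ae_mem_interval k α β] with s hs
    obtain ⟨-, h2, h3⟩ := hasDerivAt_series h hΨ m hc hs
    rw [hF, (diffExpr_kappa_pow_mul m hs h3).2]
    have h4 := h2.hasSum
    -- The term n = 0 has derivative 0; dropping it shifts the index so that term n + 1 of level m
    -- meets |n⟩ of level m + 1.
    rw [← hasSum_nat_add_iff' 1] at h4
    simp only [Finset.range_one, Finset.sum_singleton, Nat.add_zero, derivative_normPoly_zero h hΨ,
      eval_zero, Complex.ofReal_zero, mul_zero, sub_zero] at h4
    refine (h4.mul_left ((kappa k s ^ (m + 1) : ℝ) : ℂ)).congr_fun fun n => ?_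
    rw [derivative_normPoly_succ h hΨ, Nat.add_right_comm m 1 n, Nat.add_assoc]
    simp only [polyFun, eval_mul, eval_C]
    push_cast
    ring
  refine ⟨F, ⟨fun s hs => ?_, hae.symm, ?_⟩, hae'.symm⟩
  · exact (diffExpr_kappa_pow_mul m hs
      (hasDerivAt_series h hΨ m hc hs).2.2).1.differentiableAt.differentiableWithinAt
  · exact (memLp_congr_ae hae').1 (Lp.memLp _)

/-- A series `∑ c_n |n⟩` whose coefficients satisfy the recursion of a coherent state is an
eigenvector of the lowering operator. -/
theorem isEigen_tsum (h : Admissible k α β) (hΨ : ∀ l, IsPolynomialSolution k α β l (Ψ l))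
    {m : ℕ} {U : Hil k α β ≃ₗᵢ[ℂ] Hil k α β} (hU : IsShift k α β Ψ m U) {c : ℕ → ℂ} {z : ℂ}
    (hc : Summable fun n => ‖c n‖ * (1 + gap k α m n))
    (hrec : ∀ n, c (n + 1) * (√(gap k α m (n + 1)) : ℝ) = z * c n) :
    IsEigen (lowering k α β m U) z (∑' n, c n • ket k α β Ψ m n) := by
  have hcn := summable_norm_of_summable_mul_gap h m hc
  have hc' : Summable fun n => ‖c (n + 1) * (√(gap k α m (n + 1)) : ℝ)‖ := by
    simp only [hrec, norm_mul]
    exact hcn.mul_left _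
  obtain ⟨F, hF, hae⟩ := exists_isGoodRep_tsum h hΨ m hc hc'
  refine ⟨⟨F, hF⟩, ?_⟩
  change U.symm (opA k α β m ⟨_, ⟨F, hF⟩⟩) = _
  rw [LinearIsometryEquiv.symm_apply_eq, opA_apply hF, map_smul]
  have h1 : hF.2.2.toLp (diffExpr k m F) =
      ∑' n, (c (n + 1) * (√(gap k α m (n + 1)) : ℝ)) • ket k α β Ψ (m + 1) n :=
    Lp.ext (hF.2.2.coeFn_toLp.trans hae)
  have h2 := ((summable_smul_ket h hΨ m hcn).hasSum.mapL
    (U : Hil k α β →L[ℂ] Hil k α β)).const_smul z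
  rw [h1]
  simp only [hrec]
  refine HasSum.tsum_eq ?_
  convert! h2 using 1
  ext1 n
  have h3 := (isShift_iff U).1 hU n
  rw [map_smul, smul_smul]
  congr 1
  exact h3.symm

end Eigen

/-! ### Resolution of the identity for rotation invariant measures. -/

section Resolution

theorem integral_exp_int_mul_I (n : ℤ) :
    ∫ θ in Set.Ioo (-Real.pi) Real.pi, Complex.exp (n * θ * Complex.I) =
      if n = 0 then ((2 * Real.pi : ℝ) : ℂ) else 0 := by
  rw [← integral_Ioc_eq_integral_Ioo,
    ← intervalIntegral.integral_of_le (by linarith [Real.pi_pos])]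
  split_ifs with hn
  · subst hn
    simp
    ring
  · have hc : (n * Complex.I : ℂ) ≠ 0 := mul_ne_zero (Int.cast_ne_zero.2 hn) Complex.I_ne_zero
    have := integral_exp_mul_complex (a := -Real.pi) (b := Real.pi) hc
    have e : ∀ θ : ℝ, (n * θ * Complex.I : ℂ) = n * Complex.I * θ := fun θ => by ring
    simp only [e]
    rw [this, div_eq_zero_iff]
    left
    rw [sub_eq_zero, Complex.exp_eq_exp_iff_exists_int]
    exact ⟨n, by push_cast; ring⟩

/-- The measure `w(r) dr dθ` in polar coordinates. -/
def polarMeasure (w : ℝ → ℝ) : Measure ℂ :=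
  Measure.map (fun p : ℝ × ℝ => (p.1 : ℂ) * Complex.exp (p.2 * Complex.I))
    ((volume.restrict (Set.Ioi (0 : ℝ) ×ˢ Set.Ioo (-Real.pi) Real.pi)).withDensity
      fun p => ENNReal.ofReal (w p.1))

/-- The weight w(r) = r is the Jacobian of polar coordinates. -/
theorem polarMeasure_id : polarMeasure id = volume := by
  have hm : Measurable fun p : ℝ × ℝ => (p.1 : ℂ) * Complex.exp (p.2 * Complex.I) := by fun_prop
  refine Measure.ext_of_lintegral _ fun f hf => ?_
  rw [polarMeasure, lintegral_map hf hm, lintegral_withDensity_eq_lintegral_mul _ (by fun_prop)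
    (by fun_prop), ← Complex.lintegral_comp_polarCoord_symm]
  simp only [polarCoord_target, Pi.mul_apply, smul_eq_mul, id, Complex.polarCoord_symm_apply,
    Complex.exp_mul_I, Complex.ofReal_cos, Complex.ofReal_sin]

theorem prod_restrict_eq : (volume : Measure (ℝ × ℝ)).restrict
    (Set.Ioi (0 : ℝ) ×ˢ Set.Ioo (-Real.pi) Real.pi) =
    (volume.restrict (Set.Ioi 0)).prod (volume.restrict (Set.Ioo (-Real.pi) Real.pi)) := by
  rw [Measure.prod_restrict]; rfl

theorem aemeasurable_comp_fst {w : ℝ → ℝ} (hw : AEMeasurable w (volume.restrict (Set.Ioi 0))) :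
    AEMeasurable (fun p : ℝ × ℝ => ENNReal.ofReal (w p.1)) (volume.restrict
      (Set.Ioi (0 : ℝ) ×ˢ Set.Ioo (-Real.pi) Real.pi)) := by
  rw [prod_restrict_eq]
  exact (hw.comp_quasiMeasurePreserving Measure.quasiMeasurePreserving_fst).ennreal_ofReal

theorem integral_polarMeasure {w : ℝ → ℝ} (hw : AEMeasurable w (volume.restrict (Set.Ioi 0)))
    (hw0 : ∀ r, 0 < r → 0 ≤ w r) {f : ℂ → ℂ} (hf : Measurable f) :
    ∫ z, f z ∂(polarMeasure w) = ∫ p, (w p.1 : ℂ) * f (p.1 * Complex.exp (p.2 * Complex.I))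
      ∂((volume.restrict (Set.Ioi (0 : ℝ))).prod
        (volume.restrict (Set.Ioo (-Real.pi) Real.pi))) := by
  have hm : Measurable fun p : ℝ × ℝ => (p.1 : ℂ) * Complex.exp (p.2 * Complex.I) := by fun_prop
  rw [polarMeasure, integral_map hm.aemeasurable hf.aestronglyMeasurable,
    integral_withDensity_eq_integral_toReal_smul₀ (aemeasurable_comp_fst hw)
      (ae_of_all _ fun _ => ENNReal.ofReal_lt_top), ← prod_restrict_eq]
  refine setIntegral_congr_fun (measurableSet_Ioi.prod measurableSet_Ioo) fun p hp => ?_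
  rw [ENNReal.toReal_ofReal (hw0 _ hp.1), Complex.real_smul]

theorem integrable_polarMeasure_iff {w : ℝ → ℝ}
    (hw : AEMeasurable w (volume.restrict (Set.Ioi 0)))
    (hw0 : ∀ r, 0 < r → 0 ≤ w r) {f : ℂ → ℝ} (hf : Measurable f) :
    Integrable f (polarMeasure w) ↔
      Integrable (fun p : ℝ × ℝ => w p.1 * f (p.1 * Complex.exp (p.2 * Complex.I)))
      ((volume.restrict (Set.Ioi (0 : ℝ))).prod
        (volume.restrict (Set.Ioo (-Real.pi) Real.pi))) := by
  have hm : Measurable fun p : ℝ × ℝ => (p.1 : ℂ) * Complex.exp (p.2 * Complex.I) := by fun_prop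
  rw [polarMeasure, integrable_map_measure hf.aestronglyMeasurable hm.aemeasurable,
    integrable_withDensity_iff_integrable_smul₀' (aemeasurable_comp_fst hw)
      (ae_of_all _ fun _ => ENNReal.ofReal_lt_top), ← prod_restrict_eq]
  refine integrable_congr ?_
  filter_upwards [ae_restrict_mem (measurableSet_Ioi.prod measurableSet_Ioo)] with p hp
  rw [ENNReal.toReal_ofReal (hw0 _ hp.1), smul_eq_mul]
  rfl

variable {E : Type*} [NormedAddCommGroup E] [InnerProductSpace ℂ E]

/-- The hypotheses say that the functions z ↦ ⟨v z, b n⟩ are orthonormal in L²(μ). Hence ψ ↦ ⟨v ·,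
ψ⟩ is an isometry J into L²(μ), and the weak integral is ⟨Jφ, Jψ⟩ = ⟨φ, ψ⟩; integrability comes with
it. -/
theorem resolvesIdentity_of_orthonormal (b : HilbertBasis ℕ ℂ E) {μ : Measure ℂ} {v : ℂ → E}
    (hv : ∀ n, MemLp (fun z => ⟪v z, b n⟫_ℂ) 2 μ)
    (hort : ∀ i j, ∫ z, ⟪b i, v z⟫_ℂ * ⟪v z, b j⟫_ℂ ∂μ = if i = j then 1 else 0) :
    ResolvesIdentity 1 μ v := by
  set e : ℕ → Lp ℂ 2 μ := fun n => (hv n).toLp _ with he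
  have hon : Orthonormal ℂ e := by
    rw [orthonormal_iff_ite]
    intro i j
    rw [← hort i j, L2.inner_def]
    refine integral_congr_ae ?_
    filter_upwards [(hv i).coeFn_toLp, (hv j).coeFn_toLp] with z h1 h2
    rw [he, h1, h2, RCLike.inner_apply, inner_conj_symm, mul_comm]
  set J : E →ₗᵢ[ℂ] Lp ℂ 2 μ :=
    hon.orthogonalFamily.linearIsometry.comp b.repr.toLinearIsometry with hJ
  -- J is defined by an L² series; for each z the same series converges to ⟨v z, ψ⟩ by continuity of
  -- the inner product.
  have hJae : ∀ ψ, J ψ =ᵐ[μ] fun z => ⟪v z, ψ⟫_ℂ := by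
    intro ψ
    have h1 : HasSum (fun n => b.repr ψ n • e n) (J ψ) :=
      hon.orthogonalFamily.hasSum_linearIsometry (b.repr ψ)
    refine ae_eq_of_hasSum_Lp (u := fun n z => b.repr ψ n * ⟪v z, b n⟫_ℂ) h1 (fun n => ?_)
      (ae_of_all _ fun z => ?_)
    · filter_upwards [Lp.coeFn_smul (b.repr ψ n) (e n), (hv n).coeFn_toLp] with z h1 h2
      rw [h1, Pi.smul_apply, he, h2, smul_eq_mul]
    · have := (b.hasSum_repr ψ).mapL (innerSL ℂ (v z))
      simpa using this
  intro φ ψ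
  have hae : (fun z => ⟪J φ z, J ψ z⟫_ℂ) =ᵐ[μ] fun z => ⟪φ, v z⟫_ℂ * ⟪v z, ψ⟫_ℂ := by
    filter_upwards [hJae φ, hJae ψ] with z h1 h2
    rw [h1, h2, RCLike.inner_apply, inner_conj_symm, mul_comm]
  refine ⟨(L2.integrable_inner (J φ) (J ψ)).congr hae, ?_⟩
  rw [← integral_congr_ae hae, ← L2.inner_def, J.inner_map_map, Complex.ofReal_one, one_mul]

/-- Vectors with components `h(|z|) d_n z ^ n` resolve the identity with respect to a rotation
invariant measure as soon as the radial moments have the right values. -/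
theorem resolvesIdentity_polarMeasure (b : HilbertBasis ℕ ℂ E) {w h : ℝ → ℝ} {d : ℕ → ℝ}
    {v : ℂ → E} (hw : AEMeasurable w (volume.restrict (Set.Ioi 0)))
    (hw0 : ∀ r, 0 < r → 0 ≤ w r) (hh : Measurable h)
    (hv : ∀ z n, ⟪b n, v z⟫_ℂ = z ^ n * ((d n * h ‖z‖ : ℝ) : ℂ))
    (hint : ∀ n, IntegrableOn (fun r => w r * (r ^ n * (d n * h r)) ^ 2) (Set.Ioi 0))
    (hone : ∀ n, 2 * Real.pi * ∫ r in Set.Ioi (0 : ℝ), w r * (r ^ n * (d n * h r)) ^ 2 = 1) :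
    ResolvesIdentity 1 (polarMeasure w) v := by
  have hv' : ∀ z n, ⟪v z, b n⟫_ℂ = (starRingEnd ℂ) z ^ n * ((d n * h ‖z‖ : ℝ) : ℂ) := by
    intro z n
    rw [← inner_conj_symm, hv, map_mul, map_pow, Complex.conj_ofReal]
  have hnorm : ∀ r θ : ℝ, ‖(r * Complex.exp (θ * Complex.I) : ℂ)‖ = |r| := fun r θ => by
    rw [norm_mul, Complex.norm_real, Complex.norm_exp_ofReal_mul_I, mul_one, Real.norm_eq_abs]
  have hconj : Measurable (starRingEnd ℂ) := Complex.continuous_conj.measurable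
  refine resolvesIdentity_of_orthonormal b (fun n => ?_) (fun i j => ?_)
  · simp only [hv']
    have hm : Measurable fun z : ℂ => (starRingEnd ℂ) z ^ n * ((d n * h ‖z‖ : ℝ) : ℂ) := by
      fun_prop
    rw [memLp_two_iff_integrable_sq_norm hm.aestronglyMeasurable,
      integrable_polarMeasure_iff hw hw0 (by fun_prop)]
    have := Integrable.mul_prod (hint n) (ν := volume.restrict (Set.Ioo (-Real.pi) Real.pi))
      (g := fun _ => (1 : ℝ)) (integrable_const 1)
    refine this.congr ?_
    rw [← prod_restrict_eq]
    filter_upwards [ae_restrict_mem (measurableSet_Ioi.prod measurableSet_Ioo)] with p hp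
    rw [mul_one, norm_mul, norm_pow, RCLike.norm_conj, Complex.norm_real, hnorm,
      abs_of_pos (show 0 < p.1 from hp.1), mul_pow (p.1 ^ n), mul_pow (p.1 ^ n), Real.norm_eq_abs,
      sq_abs]
  · simp only [hv, hv']
    rw [integral_polarMeasure hw hw0 (by fun_prop)]
    -- The variables separate: all of the angular dependence is the character of frequency i - j.
    have e : ∀ p ∈ Set.Ioi (0 : ℝ) ×ˢ Set.Ioo (-Real.pi) Real.pi,
        (w p.1 : ℂ) * ((p.1 * Complex.exp (p.2 * Complex.I)) ^ i *
          ((d i * h ‖(p.1 * Complex.exp (p.2 * Complex.I) : ℂ)‖ : ℝ) : ℂ) *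
          ((starRingEnd ℂ) (p.1 * Complex.exp (p.2 * Complex.I)) ^ j *
          ((d j * h ‖(p.1 * Complex.exp (p.2 * Complex.I) : ℂ)‖ : ℝ) : ℂ))) =
        ((w p.1 * ((p.1 ^ i * (d i * h p.1)) * (p.1 ^ j * (d j * h p.1))) : ℝ) : ℂ) *
          Complex.exp (((i : ℤ) - (j : ℤ) : ℤ) * p.2 * Complex.I) := by
      intro p hp
      have h1 : Complex.exp (((i : ℤ) - (j : ℤ) : ℤ) * p.2 * Complex.I) =
          Complex.exp (p.2 * Complex.I) ^ i * Complex.exp (-(p.2 * Complex.I)) ^ j := by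
        rw [← Complex.exp_nat_mul, ← Complex.exp_nat_mul, ← Complex.exp_add]
        congr 1
        push_cast
        ring
      have h2 : (starRingEnd ℂ) (p.1 * Complex.exp (p.2 * Complex.I)) =
          p.1 * Complex.exp (-(p.2 * Complex.I)) := by
        rw [map_mul, Complex.conj_ofReal, ← Complex.exp_conj, map_mul, Complex.conj_ofReal,
          Complex.conj_I, mul_neg]
      rw [hnorm, abs_of_pos (show 0 < p.1 from hp.1), h1, h2]
      push_cast
      ring
    rw [← prod_restrict_eq, setIntegral_congr_fun (measurableSet_Ioi.prod measurableSet_Ioo) e,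
      prod_restrict_eq, integral_prod_mul
        (fun r : ℝ => ((w r * ((r ^ i * (d i * h r)) * (r ^ j * (d j * h r))) : ℝ) : ℂ))
        (fun θ : ℝ => Complex.exp (((i : ℤ) - (j : ℤ) : ℤ) * θ * Complex.I)),
      integral_exp_int_mul_I, integral_complex_ofReal]
    by_cases hij : i = j
    · subst hij
      rw [if_pos (by simp), if_pos rfl, ← Complex.ofReal_mul, mul_comm]
      simp only [← sq]
      rw [hone i, Complex.ofReal_one]
    · rw [if_neg (by omega), if_neg hij, mul_zero]

theorem ResolvesIdentity.of_smul_measure {μ : Measure ℂ} {v : ℂ → E} {c : ℝ} (hc : 0 < c)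
    (h : ResolvesIdentity 1 (ENNReal.ofReal c • μ) v) : ResolvesIdentity c μ v := by
  intro φ ψ
  obtain ⟨h1, h2⟩ := h φ ψ
  refine ⟨?_, ?_⟩
  · rwa [integrable_smul_measure (by simpa using hc) ENNReal.ofReal_ne_top] at h1
  · rw [integral_smul_measure, ENNReal.toReal_ofReal hc.le, Complex.ofReal_one, one_mul,
      Complex.real_smul] at h2
    exact h2

end Resolution

/-! ### Vectors with coefficients d_n z^n, d_{n+1} √gap = d_n. -/

section CoherentVector

variable {k : Kind} {α β : ℝ} {Ψ : ℕ → ℝ[X]} {m : ℕ} {d : ℕ → ℝ}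

theorem mul_le_gap (h : Admissible k α β) (m n : ℕ) : n * (-α) ≤ gap k α m n := by
  have h0 := h.alpha_neg
  cases k
  · exact le_rfl
  · exact le_rfl
  · simp only [gap]
    -- For n = 0 the factor n + 2m - 1 - α can be smaller than -α, but both sides are then 0.
    rcases n with _ | n
    · simp
    · push_cast
      have : (0 : ℝ) ≤ n := n.cast_nonneg
      have : (0 : ℝ) ≤ m := m.cast_nonneg
      exact mul_le_mul_of_nonneg_left (by linarith) (by positivity)

/-- Deliberately crude: a geometric bound means that a factor `gap` in a power series costs only the
replacement of R by 4R. -/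
theorem gap_le (k : Kind) (α : ℝ) (m n : ℕ) :
    gap k α m n ≤ (4 : ℝ) ^ n * (1 + |α| + |2 * m - 1 - α|) := by
  have h2 : (n : ℝ) ≤ 2 ^ n := by exact_mod_cast n.lt_two_pow_self.le
  have h4 : (n : ℝ) * n ≤ 4 ^ n := by
    calc (n : ℝ) * n ≤ 2 ^ n * 2 ^ n := by gcongr
      _ = 4 ^ n := by rw [← mul_pow]; norm_num
  have h5 : (n : ℝ) ≤ 4 ^ n := h2.trans (by gcongr; norm_num)
  have key : ∀ x y : ℝ, x ≤ y → (n : ℝ) * x ≤ 4 ^ n * |y| := fun x y hxy =>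
    (mul_le_mul_of_nonneg_left (hxy.trans (le_abs_self y)) n.cast_nonneg).trans
      (mul_le_mul_of_nonneg_right h5 (abs_nonneg y))
  have hp : (0 : ℝ) ≤ 4 ^ n := by positivity
  have a1 := mul_nonneg hp (abs_nonneg α)
  have a2 := mul_nonneg hp (abs_nonneg (2 * m - 1 - α))
  have e1 := key (-α) (-α) le_rfl
  have e2 := key (2 * m - 1 - α) (2 * m - 1 - α) le_rfl
  rw [abs_neg] at e1
  cases k <;> simp only [gap] <;> nlinarith

/-- Ratio test: consecutive terms have ratio R / √gap, which tends to 0. -/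
theorem summable_pow_mul (h : Admissible k α β) (hd : ∀ n, 0 < d n)
    (hrec : ∀ n, d (n + 1) * √(gap k α m (n + 1)) = d n) {R : ℝ} (hR : 0 ≤ R) :
    Summable fun n => R ^ n * d n := by
  have hlim : Tendsto (fun n : ℕ => √(gap k α m (n + 1))) atTop atTop := by
    refine Real.tendsto_sqrt_atTop.comp (tendsto_atTop_mono
      (fun n => mul_le_gap h m (n + 1)) ?_)
    refine Tendsto.atTop_mul_const (by linarith [h.alpha_neg]) ?_
    exact tendsto_natCast_atTop_atTop.comp (tendsto_add_atTop_nat 1)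
  refine summable_of_ratio_norm_eventually_le (r := 1 / 2) (by norm_num) ?_
  filter_upwards [hlim.eventually_ge_atTop (2 * R)] with n hn
  rw [Real.norm_of_nonneg (mul_nonneg (pow_nonneg hR _) (hd _).le),
    Real.norm_of_nonneg (mul_nonneg (pow_nonneg hR _) (hd _).le), ← hrec n, pow_succ]
  have h1 := mul_le_mul_of_nonneg_left hn (mul_nonneg (pow_nonneg hR n) (hd (n + 1)).le)
  nlinarith

theorem summable_pow_mul_gap (h : Admissible k α β) (hd : ∀ n, 0 < d n)
    (hrec : ∀ n, d (n + 1) * √(gap k α m (n + 1)) = d n) {R : ℝ} (hR : 0 ≤ R) :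
    Summable fun n => R ^ n * d n * (1 + gap k α m n) := by
  have h1 := summable_pow_mul h hd hrec hR
  have h4 := (summable_pow_mul h hd hrec (R := R * 4) (by positivity)).mul_right
    (1 + |α| + |2 * m - 1 - α|)
  refine Summable.of_nonneg_of_le (fun n => ?_) (fun n => ?_) (h1.add h4)
  · have := hd n
    have := gap_nonneg h m n
    positivity
  · have h5 := mul_le_mul_of_nonneg_left (gap_le k α m n)
      (mul_nonneg (pow_nonneg hR n) (hd n).le)
    rw [mul_pow]
    linarith

/-- The vector with components `d_n z ^ n` in the basis `|n⟩`. -/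
def cohVec (k : Kind) (α β : ℝ) (Ψ : ℕ → ℝ[X]) (m : ℕ) (d : ℕ → ℝ) (z : ℂ) : Hil k α β :=
  ∑' n, (z ^ n * (d n : ℂ)) • ket k α β Ψ m n

theorem norm_pow_mul_ofReal (hd : ∀ n, 0 < d n) (z : ℂ) (n : ℕ) :
    ‖z ^ n * (d n : ℂ)‖ = ‖z‖ ^ n * d n := by
  rw [norm_mul, norm_pow, Complex.norm_real, Real.norm_of_nonneg (hd n).le]

theorem summable_cohVec (h : Admissible k α β) (hΨ : ∀ l, IsPolynomialSolution k α β l (Ψ l))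
    (hd : ∀ n, 0 < d n) (hrec : ∀ n, d (n + 1) * √(gap k α m (n + 1)) = d n) (z : ℂ) :
    Summable fun n => (z ^ n * (d n : ℂ)) • ket k α β Ψ m n := by
  refine summable_smul_ket h hΨ m ?_
  simp only [norm_pow_mul_ofReal hd]
  exact summable_pow_mul h hd hrec (norm_nonneg z)

theorem continuous_cohVec (h : Admissible k α β) (hΨ : ∀ l, IsPolynomialSolution k α β l (Ψ l))
    (hd : ∀ n, 0 < d n) (hrec : ∀ n, d (n + 1) * √(gap k α m (n + 1)) = d n) :
    Continuous (cohVec k α β Ψ m d) := by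
  refine continuous_iff_continuousAt.2 fun z₀ => ?_
  have hR : 0 ≤ ‖z₀‖ + 1 := by positivity
  have hc : ContinuousOn (cohVec k α β Ψ m d) (Metric.ball 0 (‖z₀‖ + 1)) := by
    refine continuousOn_tsum (fun n => Continuous.continuousOn (by fun_prop))
      (summable_pow_mul h hd hrec hR) fun n z hz => ?_
    rw [norm_smul, norm_ket h hΨ, mul_one, norm_pow_mul_ofReal hd]
    have := hd n
    have hz' : ‖z‖ ≤ ‖z₀‖ + 1 := (mem_ball_zero_iff.1 hz).le
    gcongr
  exact hc.continuousAt (Metric.isOpen_ball.mem_nhds (by simp))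

theorem inner_ket_cohVec (h : Admissible k α β)
    (hΨ : ∀ l, IsPolynomialSolution k α β l (Ψ l)) (hd : ∀ n, 0 < d n)
    (hrec : ∀ n, d (n + 1) * √(gap k α m (n + 1)) = d n) (z : ℂ) (n : ℕ) :
    ⟪ket k α β Ψ m n, cohVec k α β Ψ m d z⟫_ℂ = z ^ n * (d n : ℂ) := by
  have h1 := (summable_cohVec h hΨ hd hrec z).hasSum.mapL (innerSL ℂ (ket k α β Ψ m n))
  have h2 : HasSum (fun j => innerSL ℂ (ket k α β Ψ m n) ((z ^ j * (d j : ℂ)) • ket k α β Ψ m j))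
      (z ^ n * (d n : ℂ)) := by
    convert! hasSum_ite_eq n (z ^ n * (d n : ℂ)) using 1
    ext1 j
    rw [innerSL_apply_apply, inner_smul_right,
      orthonormal_iff_ite.1 (orthonormal_ket h hΨ m) n j]
    by_cases hj : j = n
    · subst hj; simp
    · rw [if_neg (Ne.symm hj), if_neg hj, mul_zero]
  exact h1.unique h2

theorem hasSum_inner_cohVec_self (h : Admissible k α β)
    (hΨ : ∀ l, IsPolynomialSolution k α β l (Ψ l)) (hd : ∀ n, 0 < d n)
    (hrec : ∀ n, d (n + 1) * √(gap k α m (n + 1)) = d n) (z : ℂ) :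
    HasSum (fun n => (((‖z‖ ^ 2) ^ n * d n ^ 2 : ℝ) : ℂ))
      ⟪cohVec k α β Ψ m d z, cohVec k α β Ψ m d z⟫_ℂ := by
  convert! (ketBasis h hΨ m).hasSum_inner_mul_inner (cohVec k α β Ψ m d z)
    (cohVec k α β Ψ m d z) using 1
  ext1 n
  rw [ketBasis_apply, ← inner_conj_symm, inner_ket_cohVec h hΨ hd hrec, Complex.conj_mul',
    norm_pow_mul_ofReal hd]
  push_cast
  ring

theorem isEigen_cohVec (h : Admissible k α β) (hΨ : ∀ l, IsPolynomialSolution k α β l (Ψ l))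
    {U : Hil k α β ≃ₗᵢ[ℂ] Hil k α β} (hU : IsShift k α β Ψ m U) (hd : ∀ n, 0 < d n)
    (hrec : ∀ n, d (n + 1) * √(gap k α m (n + 1)) = d n) (z : ℂ) :
    IsEigen (lowering k α β m U) z (cohVec k α β Ψ m d z) := by
  refine isEigen_tsum h hΨ hU ?_ fun n => ?_
  · simp only [norm_pow_mul_ofReal hd]
    exact summable_pow_mul_gap h hd hrec (norm_nonneg z)
  · rw [← hrec n, pow_succ]
    push_cast
    ring

theorem IsEigen.smul {E : Type*} [NormedAddCommGroup E] [InnerProductSpace ℂ E]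
    {T : E →ₗ.[ℂ] E} {z : ℂ} {f : E} (hf : IsEigen T z f) (c : ℂ) : IsEigen T z (c • f) := by
  obtain ⟨h1, h2⟩ := hf
  refine ⟨T.domain.smul_mem c h1, ?_⟩
  have := T.map_smul c ⟨f, h1⟩
  rw [h2, smul_comm] at this
  exact this

end CoherentVector

/-! ### The cases σ = 1 and σ = s. -/

section CaseA

variable {k : Kind} {α β : ℝ} {Ψ : ℕ → ℝ[X]} {m : ℕ}

/-- The coefficients `1 / √(n! (-α) ^ n)`. -/
def coeffA (α : ℝ) (n : ℕ) : ℝ := (√(n.factorial * (-α) ^ n))⁻¹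

theorem coeffA_pos (hα : α < 0) (n : ℕ) : 0 < coeffA α n := by
  have : 0 < -α := by linarith
  unfold coeffA
  positivity

theorem coeffA_sq (hα : α < 0) (n : ℕ) : coeffA α n ^ 2 = (n.factorial * (-α) ^ n : ℝ)⁻¹ := by
  have : 0 < -α := by linarith
  rw [coeffA, inv_pow, Real.sq_sqrt (by positivity)]

theorem coeffA_succ (hα : α < 0) (hk : k = .one ∨ k = .lin) (m n : ℕ) :
    coeffA α (n + 1) * √(gap k α m (n + 1)) = coeffA α n := by
  have h1 : 0 < -α := by linarith
  have hg : gap k α m (n + 1) = (n + 1 : ℕ) * (-α) := by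
    rcases hk with rfl | rfl <;> rfl
  have h2 : (0 : ℝ) < (n + 1 : ℕ) * (-α) := by positivity
  have h3 : ((n + 1).factorial * (-α) ^ (n + 1) : ℝ) =
      (n.factorial * (-α) ^ n) * ((n + 1 : ℕ) * (-α)) := by
    rw [Nat.factorial_succ]; push_cast; ring
  rw [hg, coeffA, coeffA, h3, Real.sqrt_mul (by positivity), mul_inv, mul_assoc,
    inv_mul_cancel₀ (Real.sqrt_pos.2 h2).ne', mul_one]

theorem termA_eq (k : Kind) (α β : ℝ) (Ψ : ℕ → ℝ[X]) (m : ℕ) (z : ℂ) (n : ℕ) :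
    termA k α β Ψ m z n = (z ^ n * (coeffA α n : ℂ)) • ket k α β Ψ m n := by
  rw [termA, coeffA, div_eq_mul_inv, Complex.ofReal_inv]

theorem cohA_eq (k : Kind) (α β : ℝ) (Ψ : ℕ → ℝ[X]) (m : ℕ) (z : ℂ) :
    cohA k α β Ψ m z =
      ((Real.exp (‖z‖ ^ 2 / (2 * α)) : ℝ) : ℂ) • cohVec k α β Ψ m (coeffA α) z := by
  simp only [cohA, cohVec, termA_eq]

theorem inner_cohA_self (h : Admissible k α β) (hΨ : ∀ l, IsPolynomialSolution k α β l (Ψ l))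
    (hk : k = .one ∨ k = .lin) (z : ℂ) : ⟪cohA k α β Ψ m z, cohA k α β Ψ m z⟫_ℂ = 1 := by
  have hα := h.alpha_neg
  have h1 := hasSum_inner_cohVec_self h hΨ (coeffA_pos hα) (coeffA_succ hα hk m) z
  have h2 : HasSum (fun n => (((‖z‖ ^ 2) ^ n * coeffA α n ^ 2 : ℝ) : ℂ))
      ((Real.exp (‖z‖ ^ 2 / (-α)) : ℝ) : ℂ) := by
    rw [Complex.hasSum_ofReal]
    rw [Real.exp_eq_exp_ℝ]
    convert! NormedSpace.expSeries_div_hasSum_exp (‖z‖ ^ 2 / (-α)) using 1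
    ext1 n
    rw [coeffA_sq hα, div_pow]
    field_simp
  rw [cohA_eq, inner_smul_left, inner_smul_right, h1.unique h2, Complex.conj_ofReal,
    ← Complex.ofReal_mul, ← Complex.ofReal_mul, ← Real.exp_add, ← Real.exp_add,
    show ‖z‖ ^ 2 / (2 * α) + (‖z‖ ^ 2 / (2 * α) + ‖z‖ ^ 2 / -α) = 0 by
      have := hα.ne; field_simp; ring, Real.exp_zero, Complex.ofReal_one]

/-- Serves the normalization here and, with α = -e^u, the radial moments in the Bessel case. -/
theorem integrableOn_gaussian_moment {α : ℝ} (hα : α < 0) (n : ℕ) :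
    IntegrableOn (fun r : ℝ => r ^ (2 * n + 1) * Real.exp (r ^ 2 / α)) (Set.Ioi 0) ∧
    ∫ r in Set.Ioi (0 : ℝ), r ^ (2 * n + 1) * Real.exp (r ^ 2 / α) =
      n.factorial * (-α) ^ (n + 1) / 2 := by
  have hb : 0 < -α⁻¹ := by rw [neg_pos]; exact inv_lt_zero.2 hα
  have e : ∀ r ∈ Set.Ioi (0 : ℝ), r ^ ((2 * n + 1 : ℕ) : ℝ) * Real.exp (-(-α⁻¹) * r ^ (2 : ℝ)) =
      r ^ (2 * n + 1) * Real.exp (r ^ 2 / α) := by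
    intro r hr
    rw [Real.rpow_natCast, Real.rpow_two]
    congr 2
    ring
  have hq : (-1 : ℝ) < ((2 * n + 1 : ℕ) : ℝ) := by
    have : (0 : ℝ) ≤ ((2 * n + 1 : ℕ) : ℝ) := Nat.cast_nonneg _
    linarith
  refine ⟨(integrableOn_rpow_mul_exp_neg_mul_rpow (p := 2) hq
    (by norm_num) hb).congr_fun e measurableSet_Ioi, ?_⟩
  rw [← setIntegral_congr_fun measurableSet_Ioi e,
    integral_rpow_mul_exp_neg_mul_rpow (by norm_num) hq hb]
  have h1 : (((2 * n + 1 : ℕ) : ℝ) + 1) / 2 = (n : ℝ) + 1 := by push_cast; ring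
  rw [h1, neg_div, h1, Real.Gamma_nat_eq_factorial, Real.rpow_neg hb.le, ← Nat.cast_succ,
    Real.rpow_natCast, ← inv_pow, ← inv_neg, inv_inv, Nat.succ_eq_add_one]
  ring

theorem resolvesIdentity_cohA (h : Admissible k α β)
    (hΨ : ∀ l, IsPolynomialSolution k α β l (Ψ l)) (hk : k = .one ∨ k = .lin) :
    ResolvesIdentity (1 / (Real.pi * (-α))) volume (cohA k α β Ψ m) := by
  have hα := h.alpha_neg
  have hα' : 0 < -α := by linarith
  have hc : 0 < 1 / (Real.pi * (-α)) := by have := Real.pi_pos; positivity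
  refine ResolvesIdentity.of_smul_measure hc ?_
  -- The prefactor is absorbed into the radial weight, so that the criterion with constant 1
  -- applies.
  have hμ : ENNReal.ofReal (1 / (Real.pi * (-α))) • (volume : Measure ℂ) =
      polarMeasure (fun r => 1 / (Real.pi * (-α)) * r) := by
    rw [← polarMeasure_id, polarMeasure, polarMeasure, ← Measure.map_smul,
      ← withDensity_smul _ (by fun_prop)]
    congr 2
    ext1 p
    rw [Pi.smul_apply, smul_eq_mul, ← ENNReal.ofReal_mul hc.le, id]
  rw [hμ]
  have e : ∀ (n : ℕ) (r : ℝ), 1 / (Real.pi * (-α)) * r *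
      (r ^ n * (coeffA α n * Real.exp (r ^ 2 / (2 * α)))) ^ 2 =
      1 / (Real.pi * (-α)) * coeffA α n ^ 2 *
        (r ^ (2 * n + 1) * Real.exp (r ^ 2 / α)) := by
    intro n r
    rw [mul_pow, mul_pow, ← Real.exp_nat_mul, show ((2 : ℕ) : ℝ) * (r ^ 2 / (2 * α)) = r ^ 2 / α by
      push_cast; field_simp]
    ring
  refine resolvesIdentity_polarMeasure (ketBasis h hΨ m) (d := coeffA α)
    (h := fun r => Real.exp (r ^ 2 / (2 * α))) (by fun_prop)
    (fun r hr => by positivity) (by fun_prop) (fun z n => ?_) (fun n => ?_) (fun n => ?_)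
  · rw [ketBasis_apply, cohA_eq, inner_smul_right,
      inner_ket_cohVec h hΨ (coeffA_pos hα) (coeffA_succ hα hk m)]
    push_cast
    ring
  · simp only [e]
    exact (integrableOn_gaussian_moment hα n).1.const_mul _
  · simp only [e]
    rw [integral_const_mul, (integrableOn_gaussian_moment hα n).2, coeffA_sq hα]
    have := Real.pi_pos
    have : (n.factorial : ℝ) ≠ 0 := Nat.cast_ne_zero.2 n.factorial_ne_zero
    have := hα.ne
    field_simp
    ring

end CaseA

/-! ### The integral ∫ t^(-ν-1) e^(-t-y/t) dt and its functional equations. -/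

section BesselIntegral

theorem integrable_exp_mul_sub_exp {a : ℝ} (ha : 0 < a) :
    Integrable (fun u : ℝ => Real.exp (a * u - Real.exp u)) ∧
    ∫ u : ℝ, Real.exp (a * u - Real.exp u) = Real.Gamma a := by
  have himg : Real.exp '' Set.univ = Set.Ioi 0 := by rw [Set.image_univ, Real.range_exp]
  have hd : ∀ u ∈ Set.univ, HasDerivWithinAt Real.exp (Real.exp u) Set.univ u :=
    fun u _ => (Real.hasDerivAt_exp u).hasDerivWithinAt
  have h1 := integrableOn_image_iff_integrableOn_abs_deriv_smul MeasurableSet.univ hd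
    Real.exp_injective.injOn (fun x => Real.exp (-x) * x ^ (a - 1))
  have h2 := integral_image_eq_integral_abs_deriv_smul MeasurableSet.univ hd
    Real.exp_injective.injOn (fun x => Real.exp (-x) * x ^ (a - 1))
  have e : ∀ u, |Real.exp u| • (Real.exp (-Real.exp u) * Real.exp u ^ (a - 1)) =
      Real.exp (a * u - Real.exp u) := by
    intro u
    rw [Real.abs_exp, ← Real.exp_mul, smul_eq_mul, ← Real.exp_add, ← Real.exp_add]
    congr 1
    ring
  simp only [himg, e, integrableOn_univ, Measure.restrict_univ] at h1 h2
  exact ⟨h1.1 (Real.GammaIntegral_convergent ha), by rw [← h2, Real.Gamma_eq_integral ha]⟩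

/-- The integrand `t ^ (-ν) e ^ (-t - y / t)` in the variable `u = log t`. -/
def besselKernel (ν y u : ℝ) : ℝ := Real.exp (-ν * u - Real.exp u - y * Real.exp (-u))

/-- The integral `∫ t ^ (-ν - 1) e ^ (-t - y / t) dt` over `t > 0`. -/
def besselG (ν y : ℝ) : ℝ := ∫ u, besselKernel ν y u

theorem continuous_besselKernel (ν y : ℝ) : Continuous (besselKernel ν y) := by
  unfold besselKernel; fun_prop

/-- The bound e^(-w) ≤ N! / w^N with w = y e^(-u) compares the kernel with a Gamma integrand of
parameter N - ν, positive for N > ν. -/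
theorem integrable_besselKernel (ν : ℝ) {y : ℝ} (hy : 0 < y) : Integrable (besselKernel ν y) := by
  obtain ⟨N, hN⟩ := exists_nat_gt ν
  refine (((integrable_exp_mul_sub_exp (sub_pos.2 hN)).1).const_mul (N.factorial / y ^ N)).mono'
    (continuous_besselKernel ν y).aestronglyMeasurable (ae_of_all _ fun u => ?_)
  rw [besselKernel, Real.norm_eq_abs, Real.abs_exp]
  have h1 : Real.exp (-(y * Real.exp (-u))) ≤ N.factorial / y ^ N * Real.exp (N * u) := by
    have hw : 0 < y * Real.exp (-u) := by positivity
    have h2 := Real.pow_div_factorial_le_exp _ hw.le N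
    rw [Real.exp_neg, inv_le_comm₀ (Real.exp_pos _) (by positivity)]
    refine le_trans (le_of_eq ?_) h2
    rw [mul_pow, ← Real.exp_nat_mul, mul_inv, inv_div, ← Real.exp_neg]
    ring_nf
  calc Real.exp (-ν * u - Real.exp u - y * Real.exp (-u))
      = Real.exp (-ν * u - Real.exp u) * Real.exp (-(y * Real.exp (-u))) := by
        rw [← Real.exp_add]; ring_nf
    _ ≤ Real.exp (-ν * u - Real.exp u) * (N.factorial / y ^ N * Real.exp (N * u)) := by gcongr
    _ = N.factorial / y ^ N * Real.exp ((N - ν) * u - Real.exp u) := by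
        rw [mul_left_comm, ← Real.exp_add]; ring_nf

theorem besselKernel_anti (ν u : ℝ) {y y' : ℝ} (h : y ≤ y') :
    besselKernel ν y' u ≤ besselKernel ν y u := by
  unfold besselKernel
  gcongr

theorem besselG_nonneg (ν y : ℝ) : 0 ≤ besselG ν y :=
  integral_nonneg fun _ => (Real.exp_pos _).le

/-- Differentiation in y brings down -e^(-u), which raises the order by one. The kernel decreases in
y, so its value at y/2 dominates near y. -/
theorem hasDerivAt_besselG (ν : ℝ) {y : ℝ} (hy : 0 < y) :
    HasDerivAt (besselG ν) (-besselG (ν + 1) y) y := by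
  have hs : Set.Ioi (y / 2) ∈ 𝓝 y := isOpen_Ioi.mem_nhds (by simp only [Set.mem_Ioi]; linarith)
  have := (hasDerivAt_integral_of_dominated_loc_of_deriv_le (μ := volume) (F := besselKernel ν)
    (F' := fun y u => -besselKernel (ν + 1) y u) (bound := besselKernel (ν + 1) (y / 2)) hs
    (Eventually.of_forall fun x => (continuous_besselKernel ν x).aestronglyMeasurable)
    (integrable_besselKernel ν hy) (continuous_besselKernel (ν + 1) y).neg.aestronglyMeasurable
    (ae_of_all _ fun u x hx => ?_) (integrable_besselKernel (ν + 1) (half_pos hy))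
    (ae_of_all _ fun u x _ => ?_)).2
  · rw [integral_neg] at this
    exact this
  · rw [norm_neg, besselKernel, Real.norm_eq_abs, Real.abs_exp]
    exact besselKernel_anti (ν + 1) u (le_of_lt hx)
  · have h1 : HasDerivAt (fun x : ℝ => -ν * u - Real.exp u - x * Real.exp (-u))
        (-Real.exp (-u)) x := by
      simpa using ((hasDerivAt_id x).mul_const (Real.exp (-u))).const_sub (-ν * u - Real.exp u)
    refine h1.exp.congr_deriv ?_
    rw [mul_neg, ← Real.exp_add, besselKernel]
    ring_nf

/-- The derivative in u of the kernel of order ν + 1 has integral 0. -/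
theorem besselG_recurrence (ν : ℝ) {y : ℝ} (hy : 0 < y) :
    y * besselG (ν + 2) y = (1 + ν) * besselG (ν + 1) y + besselG ν y := by
  have hd : ∀ u, HasDerivAt (besselKernel (ν + 1) y)
      (-(1 + ν) * besselKernel (ν + 1) y u - besselKernel ν y u + y * besselKernel (ν + 2) y u)
      u := by
    intro u
    have h1 : HasDerivAt (fun u : ℝ => -(ν + 1) * u - Real.exp u - y * Real.exp (-u))
        (-(ν + 1) - Real.exp u + y * Real.exp (-u)) u := by
      have := (((hasDerivAt_id u).const_mul (-(ν + 1))).sub (Real.hasDerivAt_exp u)).sub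
        (((hasDerivAt_id u).neg.exp).const_mul y)
      refine this.congr_deriv ?_
      simp
    refine h1.exp.congr_deriv ?_
    have e1 : besselKernel ν y u = besselKernel (ν + 1) y u * Real.exp u := by
      rw [besselKernel, besselKernel, ← Real.exp_add]; ring_nf
    have e2 : besselKernel (ν + 2) y u = besselKernel (ν + 1) y u * Real.exp (-u) := by
      rw [besselKernel, besselKernel, ← Real.exp_add]; ring_nf
    rw [e1, e2, besselKernel]
    ring
  have i0 := integrable_besselKernel ν hy
  have i1 := integrable_besselKernel (ν + 1) hy
  have i2 := integrable_besselKernel (ν + 2) hy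
  have i01 : Integrable fun u => -(1 + ν) * besselKernel (ν + 1) y u - besselKernel ν y u :=
    (i1.const_mul _).sub i0
  have h0 := integral_eq_zero_of_hasDerivAt_of_integrable hd (i01.add (i2.const_mul _)) i1
  rw [integral_add i01 (i2.const_mul _), integral_sub (i1.const_mul _) i0,
    integral_const_mul, integral_const_mul] at h0
  unfold besselG
  linarith

/-- Substitution u ↦ log y - u, that is, t ↦ y / t. -/
theorem besselG_neg (ν : ℝ) {y : ℝ} (hy : 0 < y) : besselG (-ν) y = y ^ ν * besselG ν y := by
  have h1 := integral_sub_left_eq_self (besselKernel (-ν) y) volume (Real.log y)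
  unfold besselG
  rw [← h1, ← integral_const_mul]
  congr 1
  ext1 u
  have e1 : Real.exp (Real.log y - u) = y * Real.exp (-u) := by
    rw [sub_eq_add_neg, Real.exp_add, Real.exp_log hy]
  have e2 : y * Real.exp (-(Real.log y - u)) = Real.exp u := by
    rw [neg_sub, Real.exp_sub, Real.exp_log hy, mul_div_cancel₀ _ hy.ne']
  rw [besselKernel, besselKernel, Real.rpow_def_of_pos hy, ← Real.exp_add, e1, e2]
  congr 1
  ring

theorem tendsto_besselG_zero {ν : ℝ} (hν : ν < 0) :
    Tendsto (besselG ν) (𝓝[>] 0) (𝓝 (Real.Gamma (-ν))) := by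
  have h1 := integrable_exp_mul_sub_exp (neg_pos.2 hν)
  rw [← h1.2]
  refine tendsto_integral_filter_of_dominated_convergence
    (fun u => Real.exp (-ν * u - Real.exp u))
    (Eventually.of_forall fun y => (continuous_besselKernel ν y).aestronglyMeasurable) ?_ h1.1 ?_
  · filter_upwards [self_mem_nhdsWithin] with y hy
    refine ae_of_all _ fun u => ?_
    rw [besselKernel, Real.norm_eq_abs, Real.abs_exp, Real.exp_le_exp]
    have : 0 < y * Real.exp (-u) := mul_pos hy (Real.exp_pos _)
    linarith
  · refine ae_of_all _ fun u => ?_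
    have : Continuous fun y => besselKernel ν y u := by unfold besselKernel; fun_prop
    have := this.tendsto 0
    simp only [besselKernel, zero_mul, sub_zero] at this
    exact this.mono_left nhdsWithin_le_nhds

theorem continuous_besselG_order {y : ℝ} (hy : 0 < y) : Continuous fun ν => besselG ν y := by
  refine continuous_iff_continuousAt.2 fun ν₀ => ?_
  -- For |ν - ν₀| < 1 the factor e^(-νu) is largest at one of the two end orders, which one
  -- depending on the sign of u; the sum of both kernels dominates.
  refine continuousAt_of_dominated (bound := fun u => besselKernel (ν₀ - 1) y u +
    besselKernel (ν₀ + 1) y u) (Eventually.of_forall fun ν =>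
      (continuous_besselKernel ν y).aestronglyMeasurable) ?_
    ((integrable_besselKernel _ hy).add (integrable_besselKernel _ hy)) ?_
  · have hs : Set.Ioo (ν₀ - 1) (ν₀ + 1) ∈ 𝓝 ν₀ := Ioo_mem_nhds (by linarith) (by linarith)
    filter_upwards [hs] with ν hν
    refine ae_of_all _ fun u => ?_
    rw [Real.norm_eq_abs, besselKernel, Real.abs_exp]
    rcases le_total 0 u with hu | hu
    · refine le_add_of_le_of_nonneg ?_ (Real.exp_pos _).le
      rw [besselKernel, Real.exp_le_exp]
      nlinarith [hν.1]
    · refine le_add_of_nonneg_of_le (Real.exp_pos _).le ?_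
      rw [besselKernel, Real.exp_le_exp]
      nlinarith [hν.2]
  · refine ae_of_all _ fun u => Continuous.continuousAt ?_
    unfold besselKernel
    fun_prop

theorem continuousOn_besselG (ν : ℝ) : ContinuousOn (besselG ν) (Set.Ioi 0) := fun _ hy =>
  (hasDerivAt_besselG ν hy).continuousAt.continuousWithinAt

end BesselIntegral

/-! ### The series side: the same functional equations. -/

section BesselSeries

/-- With Γ equal to 0 at its poles and 0⁻¹ = 0, the reciprocal is the entire function 1/Γ, so no
argument has to be excluded. -/
theorem one_div_Gamma_eq (x : ℝ) : (Real.Gamma x)⁻¹ = x * (Real.Gamma (x + 1))⁻¹ := by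
  by_cases hx : x = 0
  · simp [hx]
  · rw [Real.Gamma_add_one hx, mul_inv, mul_inv_cancel_left₀ hx]

/-- The coefficients of the entire function `∑ y ^ n / (n! Γ(ν + n + 1))`. -/
def besselCoeff (ν : ℝ) (n : ℕ) : ℝ := (n.factorial : ℝ)⁻¹ * (Real.Gamma (ν + n + 1))⁻¹

/-- The entire function `∑ y ^ n / (n! Γ(ν + n + 1))`. -/
def besselF (ν y : ℝ) : ℝ := ∑' n, besselCoeff ν n * y ^ n

theorem besselCoeff_succ (ν : ℝ) (n : ℕ) :
    ((n : ℝ) + 1) * besselCoeff ν (n + 1) = besselCoeff (ν + 1) n := by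
  unfold besselCoeff
  rw [Nat.factorial_succ]
  push_cast
  rw [mul_inv, ← mul_assoc, ← mul_assoc, mul_inv_cancel₀ (by positivity), one_mul]
  ring_nf

theorem besselCoeff_order_succ (ν : ℝ) (n : ℕ) :
    besselCoeff ν n = (ν + n + 1) * besselCoeff (ν + 1) n := by
  unfold besselCoeff
  rw [one_div_Gamma_eq]
  ring_nf

theorem summable_besselF (ν y : ℝ) : Summable fun n => besselCoeff ν n * y ^ n := by
  have hlim : Tendsto (fun n : ℕ => ν + n + 1) atTop atTop :=
    tendsto_atTop_add_const_right _ _ (tendsto_atTop_add_const_left _ _ tendsto_natCast_atTop_atTop)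
  refine summable_of_ratio_norm_eventually_le (r := 1 / 2) (by norm_num) ?_
  filter_upwards [hlim.eventually_ge_atTop (2 * |y| + 1)] with n hn
  have h1 := besselCoeff_succ ν n
  have h2 := besselCoeff_order_succ ν n
  rw [← h1] at h2
  have h3 : |y| ≤ (ν + n + 1) * ((n : ℝ) + 1) / 2 := by
    have : (0 : ℝ) ≤ n := n.cast_nonneg
    have := abs_nonneg y
    nlinarith
  rw [h2, pow_succ, norm_mul, norm_mul, norm_mul, norm_mul, norm_mul, Real.norm_eq_abs y,
    Real.norm_of_nonneg (show 0 ≤ ν + n + 1 by linarith [abs_nonneg y]),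
    Real.norm_of_nonneg (show (0 : ℝ) ≤ n + 1 by positivity)]
  have h4 := mul_le_mul_of_nonneg_left h3
    (mul_nonneg (norm_nonneg (besselCoeff ν (n + 1))) (norm_nonneg (y ^ n)))
  linarith

theorem hasDerivAt_besselF (ν y : ℝ) : HasDerivAt (besselF ν) (besselF (ν + 1) y) y := by
  set R := |y| + 1 with hR
  have hRpos : 0 < R := by positivity
  have hy : y ∈ Set.Ioo (-R) R := abs_lt.1 (by rw [hR]; linarith)
  have hsum : Summable fun n : ℕ => ‖besselCoeff ν n * (n * R ^ (n - 1))‖ := by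
    rw [← summable_nat_add_iff 1]
    refine (summable_besselF (ν + 1) R).norm.congr fun n => ?_
    rw [← besselCoeff_succ, Nat.add_sub_cancel]
    push_cast
    ring_nf
  have := hasDerivAt_tsum_of_isPreconnected (g := fun n y => besselCoeff ν n * y ^ n)
    (g' := fun n y => besselCoeff ν n * (n * y ^ (n - 1))) hsum isOpen_Ioo isPreconnected_Ioo
    (fun n x _ => (hasDerivAt_pow n x).const_mul _) (fun n x hx => ?_) hy (summable_besselF ν y) hy
  · refine this.congr_deriv ?_
    have hs : Summable fun n : ℕ => besselCoeff ν n * (n * y ^ (n - 1)) := by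
      rw [← summable_nat_add_iff 1]
      refine (summable_besselF (ν + 1) y).congr fun n => ?_
      rw [← besselCoeff_succ, Nat.add_sub_cancel]
      push_cast
      ring
    rw [hs.tsum_eq_zero_add, besselF]
    simp only [Nat.cast_zero, zero_mul, mul_zero, zero_add]
    refine tsum_congr fun n => ?_
    rw [← besselCoeff_succ, Nat.add_sub_cancel]
    push_cast
    ring
  · rw [norm_mul, norm_mul, norm_mul, norm_mul, norm_pow, norm_pow, Real.norm_eq_abs x,
      Real.norm_of_nonneg hRpos.le]
    have : |x| ≤ R := (abs_lt.2 hx).le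
    gcongr

theorem besselF_recurrence (ν y : ℝ) :
    y * besselF (ν + 2) y + (1 + ν) * besselF (ν + 1) y = besselF ν y := by
  have s2 := (summable_besselF (ν + 2) y).hasSum.mul_left y
  have s1 := (summable_besselF (ν + 1) y).hasSum
  have s0 := (summable_besselF ν y).hasSum
  have s1' : HasSum (fun n : ℕ => (n * besselCoeff (ν + 1) n) * y ^ n)
      (y * besselF (ν + 2) y) := by
    rw [← hasSum_nat_add_iff' 1]
    simp only [Finset.range_one, Finset.sum_singleton, Nat.cast_zero, zero_mul, sub_zero]
    refine s2.congr_fun fun n => ?_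
    rw [show ν + 2 = ν + 1 + 1 by ring, ← besselCoeff_succ (ν + 1) n]
    push_cast
    ring
  refine (s1'.add (s1.mul_left (1 + ν))).unique (s0.congr_fun fun n => ?_)
  rw [besselCoeff_order_succ ν n]
  ring

theorem besselF_zero (ν : ℝ) : besselF ν 0 = (Real.Gamma (ν + 1))⁻¹ := by
  rw [besselF, tsum_eq_single 0 fun n hn => by rw [zero_pow hn, mul_zero]]
  simp [besselCoeff]

theorem continuous_besselF (ν : ℝ) : Continuous (besselF ν) :=
  continuous_iff_continuousAt.2 fun y => (hasDerivAt_besselF ν y).continuousAt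

/-- The combination of the series that represents `besselG`. -/
def besselR (ν y : ℝ) : ℝ :=
  Real.pi / Real.sin (ν * Real.pi) * (y ^ (-ν) * besselF (-ν) y - besselF ν y)

theorem sin_add_one_mul_pi (ν : ℝ) :
    Real.sin ((ν + 1) * Real.pi) = -Real.sin (ν * Real.pi) := by
  rw [add_mul, one_mul, Real.sin_add_pi]

/-- Together with `besselR_recurrence` and `besselR_neg` this shows that `besselR` obeys the same
derivative rule, recurrence and reflection as `besselG`. The sign comes from sin((ν + 1)π) =
-sin(νπ). -/
theorem hasDerivAt_besselR (ν : ℝ) {y : ℝ} (hy : 0 < y) :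
    HasDerivAt (besselR ν) (-besselR (ν + 1) y) y := by
  have h1 := (Real.hasDerivAt_rpow_const (p := -ν) (Or.inl hy.ne')).mul (hasDerivAt_besselF (-ν) y)
  have h2 := (h1.sub (hasDerivAt_besselF ν y)).const_mul (Real.pi / Real.sin (ν * Real.pi))
  refine h2.congr_deriv ?_
  have h3 := besselF_recurrence (-ν - 1) y
  have e1 : -ν - 1 + 2 = -ν + 1 := by ring
  have e2 : -ν - 1 + 1 = -ν := by ring
  have e3 : -(ν + 1) = -ν - 1 := by ring
  have e4 : y ^ (-ν) = y ^ (-ν - 1) * y := by rw [← Real.rpow_add_one hy.ne']; ring_nf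
  rw [e1, e2] at h3
  rw [besselR, sin_add_one_mul_pi, e3, ← h3, e4, div_neg]
  ring

theorem besselR_recurrence (ν : ℝ) {y : ℝ} (hy : 0 < y) :
    y * besselR (ν + 2) y = (1 + ν) * besselR (ν + 1) y + besselR ν y := by
  have h1 := besselF_recurrence ν y
  have h2 := besselF_recurrence (-ν - 2) y
  have e1 : -ν - 2 + 2 = -ν := by ring
  have e2 : -ν - 2 + 1 = -ν - 1 := by ring
  rw [e1, e2] at h2
  have e3 : y ^ (-ν) = y ^ (-ν - 2) * y * y := by
    rw [← Real.rpow_add_one hy.ne', ← Real.rpow_add_one hy.ne']; ring_nf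
  have e4 : y ^ (-ν - 1) = y ^ (-ν - 2) * y := by
    rw [← Real.rpow_add_one hy.ne']; ring_nf
  have hs : Real.sin ((ν + 2) * Real.pi) = Real.sin (ν * Real.pi) := by
    rw [show ν + 2 = ν + 1 + 1 by ring, sin_add_one_mul_pi, sin_add_one_mul_pi, neg_neg]
  simp only [besselR]
  rw [sin_add_one_mul_pi, hs, show -(ν + 2) = -ν - 2 by ring, show -(ν + 1) = -ν - 1 by ring, ← h1,
    ← h2, e3, e4, div_neg]
  ring

theorem besselR_neg (ν : ℝ) {y : ℝ} (hy : 0 < y) : besselR (-ν) y = y ^ ν * besselR ν y := by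
  have h : y ^ ν * y ^ (-ν) = 1 := by rw [← Real.rpow_add hy, add_neg_cancel, Real.rpow_zero]
  rw [besselR, besselR, neg_neg, neg_mul, Real.sin_neg, div_neg]
  linear_combination -(Real.pi / Real.sin (ν * Real.pi) * besselF (-ν) y) * h

end BesselSeries

/-! ### Integral and series agree; the integral representation of K. -/

section BesselIdentity

theorem tendsto_rpow_zero_nhdsGT {p : ℝ} (hp : 0 < p) :
    Tendsto (fun y : ℝ => y ^ p) (𝓝[>] 0) (𝓝 0) := by
  have := (Real.continuousAt_rpow_const 0 p (Or.inr hp.le)).tendsto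
  rw [Real.zero_rpow hp.ne'] at this
  exact this.mono_left nhdsWithin_le_nhds

/-- A solution `D` of `(y ^ (1 + ν) D')' = y ^ ν D` for which `D` and `y ^ (1 + ν) D'` vanish at
the origin is zero. -/
theorem eq_zero_of_modifiedBessel {ν : ℝ} (h1 : -1 < ν) (h0 : ν < 0) {D W : ℝ → ℝ}
    (hD : ∀ y, 0 < y → HasDerivAt D (-(y ^ (-1 - ν) * W y)) y)
    (hW : ∀ y, 0 < y → HasDerivAt W (-(y ^ ν * D y)) y)
    (hD0 : Tendsto D (𝓝[>] 0) (𝓝 0)) (hW0 : Tendsto W (𝓝[>] 0) (𝓝 0)) {y : ℝ} (hy : 0 < y) :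
    D y = 0 ∧ W y = 0 := by
  -- Φ is an antiderivative of y^(-1-ν) + y^ν; both of its exponents are positive because -1 < ν <
  -- 0, so Φ ≥ 0.
  set Φ : ℝ → ℝ := fun y => y ^ (-ν) / (-ν) + y ^ (1 + ν) / (1 + ν) with hΦ
  have hΦd : ∀ y, 0 < y → HasDerivAt Φ (y ^ (-1 - ν) + y ^ ν) y := by
    intro y hy
    have a := (Real.hasDerivAt_rpow_const (p := -ν) (Or.inl hy.ne')).div_const (-ν)
    have b := (Real.hasDerivAt_rpow_const (p := 1 + ν) (Or.inl hy.ne')).div_const (1 + ν)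
    refine (a.add b).congr_deriv ?_
    rw [mul_div_cancel_left₀ _ (by linarith : -ν ≠ 0),
      mul_div_cancel_left₀ _ (by linarith : 1 + ν ≠ 0)]
    ring_nf
  -- Gronwall argument: E' = -(y^(-1-ν) + y^ν) (D + W)² e^(-Φ) ≤ 0, while E ≥ 0 tends to 0 at the
  -- origin.
  set E : ℝ → ℝ := fun y => (D y ^ 2 + W y ^ 2) * Real.exp (-Φ y) with hE
  have hEd : ∀ y, 0 < y → HasDerivAt E
      ((2 * D y * (-(y ^ (-1 - ν) * W y)) + 2 * W y * (-(y ^ ν * D y))) * Real.exp (-Φ y) +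
        (D y ^ 2 + W y ^ 2) * (Real.exp (-Φ y) * -(y ^ (-1 - ν) + y ^ ν))) y := by
    intro y hy
    refine ((((hD y hy).pow 2).add ((hW y hy).pow 2)).mul (hΦd y hy).neg.exp).congr_deriv ?_
    simp
  have hanti : AntitoneOn E (Set.Ioi 0) := by
    refine antitoneOn_of_deriv_nonpos (convex_Ioi 0)
      (fun y hy => (hEd y hy).continuousAt.continuousWithinAt) (fun y hy => ?_) (fun y hy => ?_)
    · rw [interior_Ioi] at hy
      exact (hEd y hy).differentiableAt.differentiableWithinAt
    · rw [interior_Ioi] at hy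
      have hy' : 0 < y := hy
      rw [(hEd y hy).deriv]
      have p1 : 0 ≤ Real.exp (-Φ y) * (y ^ (-1 - ν) + y ^ ν) := by positivity
      nlinarith [mul_nonneg p1 (sq_nonneg (D y + W y))]
  have hlim : Tendsto E (𝓝[>] 0) (𝓝 0) := by
    have hb : Tendsto (fun y => D y ^ 2 + W y ^ 2) (𝓝[>] 0) (𝓝 0) := by
      simpa using (hD0.pow 2).add (hW0.pow 2)
    refine squeeze_zero' (Eventually.of_forall fun y => by positivity) ?_ hb
    filter_upwards [self_mem_nhdsWithin] with y hy
    have hy' : 0 < y := hy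
    refine mul_le_of_le_one_right (by positivity) ?_
    rw [Real.exp_le_one_iff, neg_nonpos]
    have : 0 < -ν := by linarith
    have : 0 < 1 + ν := by linarith
    positivity
  have hle : E y ≤ 0 := by
    refine ge_of_tendsto hlim ?_
    filter_upwards [Ioo_mem_nhdsGT hy] with x hx
    exact hanti hx.1 hy hx.2.le
  have hle' : D y ^ 2 + W y ^ 2 ≤ 0 := by
    by_contra hcon
    push Not at hcon
    exact absurd hle (not_le.2 (mul_pos hcon (Real.exp_pos _)))
  constructor <;> nlinarith [sq_nonneg (D y), sq_nonneg (W y)]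

/-- The difference of the two sides, with W = y^(1+ν) times the difference at order ν + 1, solves
the system of `eq_zero_of_modifiedBessel`. The values at the origin match by the reflection formula
for Γ; for W they are found after replacing y^(1+ν) `besselG (ν + 1) y` by `besselG (-(1 + ν)) y`.
-/
theorem besselG_eq_besselR_of_mem_Ioo {ν : ℝ} (h1 : -1 < ν) (h0 : ν < 0) {y : ℝ} (hy : 0 < y) :
    besselG ν y = besselR ν y := by
  have hrefl : ∀ x, Real.Gamma x * Real.Gamma (1 - x) = Real.pi / Real.sin (x * Real.pi) :=
    fun x => by rw [Real.Gamma_mul_Gamma_one_sub, mul_comm x]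
  have hG1 : Real.Gamma (1 + ν) ≠ 0 := (Real.Gamma_pos_of_pos (by linarith)).ne'
  have hG2 : Real.Gamma (-ν) ≠ 0 := (Real.Gamma_pos_of_pos (by linarith)).ne'
  have c1 : Real.pi / Real.sin (ν * Real.pi) = -(Real.Gamma (-ν) * Real.Gamma (1 + ν)) := by
    have := hrefl (-ν)
    rw [sub_neg_eq_add, neg_mul, Real.sin_neg, div_neg] at this
    rw [this, neg_neg]
  have key := eq_zero_of_modifiedBessel (D := fun y => besselG ν y - besselR ν y)
    (W := fun y => y ^ (1 + ν) * (besselG (ν + 1) y - besselR (ν + 1) y)) h1 h0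
    (fun y hy => ?_) (fun y hy => ?_) ?_ ?_ hy
  · exact sub_eq_zero.1 key.1
  · refine ((hasDerivAt_besselG ν hy).sub (hasDerivAt_besselR ν hy)).congr_deriv ?_
    rw [← mul_assoc, ← Real.rpow_add hy, show -1 - ν + (1 + ν) = 0 by ring, Real.rpow_zero]
    ring
  · refine ((Real.hasDerivAt_rpow_const (p := 1 + ν) (Or.inl hy.ne')).mul
      ((hasDerivAt_besselG (ν + 1) hy).sub (hasDerivAt_besselR (ν + 1) hy))).congr_deriv ?_
    have r1 := besselG_recurrence ν hy
    have r2 := besselR_recurrence ν hy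
    have e : y ^ (1 + ν) = y ^ ν * y := by rw [← Real.rpow_add_one hy.ne', add_comm]
    rw [show ν + 1 + 1 = ν + 2 by ring, show 1 + ν - 1 = ν by ring, e, Pi.sub_apply]
    linear_combination -(y ^ ν) * r1 + y ^ ν * r2
  · have t1 := tendsto_besselG_zero h0
    have t2 : Tendsto (besselR ν) (𝓝[>] 0) (𝓝 (Real.pi / Real.sin (ν * Real.pi) *
        (0 * besselF (-ν) 0 - besselF ν 0))) :=
      (((tendsto_rpow_zero_nhdsGT (neg_pos.2 h0)).mul
        (((continuous_besselF (-ν)).tendsto 0).mono_left nhdsWithin_le_nhds)).sub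
        (((continuous_besselF ν).tendsto 0).mono_left nhdsWithin_le_nhds)).const_mul _
    convert! t1.sub t2 using 2
    rw [c1, besselF_zero ν, add_comm ν 1]
    field_simp
    ring
  · have t1 := tendsto_besselG_zero (ν := -(1 + ν)) (by linarith)
    have t2 : Tendsto (fun y => Real.pi / Real.sin ((ν + 1) * Real.pi) *
        (besselF (-(ν + 1)) y - y ^ (1 + ν) * besselF (ν + 1) y)) (𝓝[>] 0)
        (𝓝 (Real.pi / Real.sin ((ν + 1) * Real.pi) *
        (besselF (-(ν + 1)) 0 - 0 * besselF (ν + 1) 0))) :=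
      ((((continuous_besselF _).tendsto 0).mono_left nhdsWithin_le_nhds).sub
        ((tendsto_rpow_zero_nhdsGT (by linarith)).mul
        (((continuous_besselF (ν + 1)).tendsto 0).mono_left nhdsWithin_le_nhds))).const_mul _
    have t3 := t1.sub t2
    have hz : Real.Gamma (-(-(1 + ν))) - Real.pi / Real.sin ((ν + 1) * Real.pi) *
        (besselF (-(ν + 1)) 0 - 0 * besselF (ν + 1) 0) = 0 := by
      rw [sin_add_one_mul_pi, div_neg, c1, besselF_zero, neg_neg, neg_neg,
        show -(ν + 1) + 1 = -ν by ring]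
      field_simp
      ring
    rw [hz] at t3
    refine t3.congr' ?_
    filter_upwards [self_mem_nhdsWithin] with x hx
    have hx' : 0 < x := hx
    have h : x ^ (1 + ν) * x ^ (-(ν + 1)) = 1 := by
      rw [← Real.rpow_add hx', show 1 + ν + -(ν + 1) = 0 by ring, Real.rpow_zero]
    rw [besselG_neg _ hx', add_comm 1 ν, besselR]
    rw [add_comm 1 ν] at h
    linear_combination (Real.pi / Real.sin ((ν + 1) * Real.pi) * besselF (-(ν + 1)) x) * h

/-- Differentiating the identity raises the order by one, which leads from (-1, 0) to all
non-integer ν > -1; reflection ν ↦ -ν covers the rest. -/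
theorem besselG_eq_besselR {ν : ℝ} (hν : ∀ n : ℤ, (n : ℝ) ≠ ν) {y : ℝ} (hy : 0 < y) :
    besselG ν y = besselR ν y := by
  have step : ∀ (n : ℕ) (ν : ℝ), -1 < ν → ν < 0 → ∀ y, 0 < y →
      besselG (ν + n) y = besselR (ν + n) y := by
    intro n ν h1 h0
    induction n with
    | zero => intro y hy; simpa using besselG_eq_besselR_of_mem_Ioo h1 h0 hy
    | succ n ih =>
      intro y hy
      have h2 := hasDerivAt_besselG (ν + n) hy
      have h3 : besselG (ν + n) =ᶠ[𝓝 y] besselR (ν + n) := by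
        filter_upwards [isOpen_Ioi.mem_nhds hy] with x hx using ih x hx
      have h4 := ((hasDerivAt_besselR (ν + n) hy).congr_of_eventuallyEq h3).unique h2
      push_cast
      rw [← add_assoc]
      exact (neg_inj.1 h4).symm
  have pos : ∀ ν : ℝ, (∀ n : ℤ, (n : ℝ) ≠ ν) → -1 < ν → besselG ν y = besselR ν y := by
    intro ν hν h1
    have hf : 0 ≤ ⌊ν⌋ + 1 := by
      have : -1 ≤ ⌊ν⌋ := Int.le_floor.2 (by push_cast; exact h1.le)
      omega
    have hfl : (⌊ν⌋ : ℝ) < ν := lt_of_le_of_ne (Int.floor_le ν) (hν _)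
    have := step (⌊ν⌋ + 1).toNat (ν - (⌊ν⌋ + 1)) (by linarith)
      (by linarith [Int.lt_floor_add_one ν]) y hy
    have e : (((⌊ν⌋ + 1).toNat : ℕ) : ℝ) = ⌊ν⌋ + 1 := by
      have : (((⌊ν⌋ + 1).toNat : ℕ) : ℤ) = ⌊ν⌋ + 1 := Int.toNat_of_nonneg hf
      exact_mod_cast this
    rw [e, sub_add_cancel] at this
    exact this
  by_cases h : -1 < ν
  · exact pos ν hν h
  · have h2 := pos (-ν) (fun n hn => hν (-n) (by push_cast; linarith)) (by linarith)
    rw [besselG_neg ν hy, besselR_neg ν hy] at h2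
    exact mul_left_cancel₀ (Real.rpow_pos_of_pos hy ν).ne' h2

theorem besselI_eq (ν : ℝ) {x : ℝ} (hx : 0 < x) :
    besselI ν x = (x / 2) ^ ν * besselF ν ((x / 2) ^ 2) := by
  rw [besselI, besselF, ← tsum_mul_left]
  refine tsum_congr fun n => ?_
  have h : 0 < x / 2 := half_pos hx
  rw [besselCoeff, Real.rpow_add h, ← pow_mul, ← Real.rpow_natCast (x / 2) (2 * n), div_eq_mul_inv,
    mul_inv]
  push_cast
  ring

theorem besselKQuot_eq {ν : ℝ} (hν : ∀ n : ℤ, (n : ℝ) ≠ ν) {x : ℝ} (hx : 0 < x) :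
    besselKQuot ν x = (x / 2) ^ ν * besselG ν ((x / 2) ^ 2) / 2 := by
  have h : 0 < x / 2 := half_pos hx
  have e : (x / 2) ^ (-ν) = (x / 2) ^ ν * ((x / 2) ^ 2) ^ (-ν) := by
    rw [← Real.rpow_natCast, ← Real.rpow_mul h.le, ← Real.rpow_add h]
    push_cast
    ring_nf
  rw [besselKQuot, besselI_eq _ hx, besselI_eq _ hx, besselG_eq_besselR hν (by positivity),
    besselR, e]
  ring

/-- The integral is continuous in the order, so it also equals the limit that defines K at integer
orders. -/
theorem besselK_eq (ν : ℝ) {x : ℝ} (hx : 0 < x) :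
    besselK ν x = (x / 2) ^ ν * besselG ν ((x / 2) ^ 2) / 2 := by
  rw [besselK]
  split_ifs with hν
  · refine Tendsto.limUnder_eq ?_
    have hc : Continuous fun ν => (x / 2) ^ ν * besselG ν ((x / 2) ^ 2) / 2 :=
      ((Real.continuous_const_rpow (half_pos hx).ne').mul
        (continuous_besselG_order (by positivity))).div_const 2
    refine (hc.continuousAt.tendsto.mono_left nhdsWithin_le_nhds).congr' ?_
    obtain ⟨n, rfl⟩ := hν
    -- This neighbourhood contains no integer but n, so the non-integer formula holds on it away
    -- from n.
    have hs : Set.Ioo ((n : ℝ) - 1) (n + 1) ∈ 𝓝 (n : ℝ) :=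
      Ioo_mem_nhds (by linarith) (by linarith)
    filter_upwards [nhdsWithin_le_nhds hs, self_mem_nhdsWithin] with ν hν hne
    refine (besselKQuot_eq (fun j hj => hne ?_) hx).symm
    subst hj
    have h1 : n - 1 < j := by exact_mod_cast hν.1
    have h2 : j < n + 1 := by exact_mod_cast hν.2
    rw [show j = n by omega]
    rfl
  · exact besselKQuot_eq (fun n hn => hν ⟨n, hn⟩) hx

end BesselIdentity

/-! ### The radial density and its moments. -/

section RadialDensity

/-- In this form the density is visibly nonnegative and continuous for r > 0, and its moments can be
computed by Fubini's theorem. -/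
theorem bgDensity_eq (α : ℝ) (m : ℕ) {r : ℝ} (hr : 0 < r) :
    bgDensity α m r =
      r / (Real.pi * Real.Gamma (2 * m - α)) * besselG (1 - (2 * m - α)) (r ^ 2) := by
  have e : r ^ (2 * m - α) * r ^ (1 - (2 * m - α)) = r := by
    rw [← Real.rpow_add hr, add_sub_cancel, Real.rpow_one]
  rw [bgDensity, besselK_eq _ (by positivity), mul_div_cancel_left₀ r two_ne_zero,
    show α + 1 - 2 * m = 1 - (2 * m - α) by ring]
  linear_combination (1 / (Real.pi * Real.Gamma (2 * m - α)) *
    besselG (1 - (2 * m - α)) (r ^ 2)) * e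

/-- By Fubini, the integral over r is a Gaussian moment of width e^u, equal to n! e^((n+1)u) / 2.
The remaining integral over u has exponent (n + 1) - (1 - c) = n + c and is Γ(n + c). -/
theorem besselG_moment {c : ℝ} (hc : 0 < c) (n : ℕ) :
    IntegrableOn (fun r : ℝ => r ^ (2 * n + 1) * besselG (1 - c) (r ^ 2)) (Set.Ioi 0) ∧
    ∫ r in Set.Ioi (0 : ℝ), r ^ (2 * n + 1) * besselG (1 - c) (r ^ 2) =
      n.factorial * Real.Gamma (n + c) / 2 := by
  have ek : ∀ r u : ℝ, r ^ (2 * n + 1) * besselKernel (1 - c) (r ^ 2) u =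
      r ^ (2 * n + 1) * Real.exp (r ^ 2 / (-Real.exp u)) *
        Real.exp (-(1 - c) * u - Real.exp u) := by
    intro r u
    rw [besselKernel, mul_assoc, ← Real.exp_add, div_neg, div_eq_mul_inv, ← Real.exp_neg]
    ring_nf
  have hmom := fun u : ℝ => integrableOn_gaussian_moment (neg_lt_zero.2 (Real.exp_pos u)) n
  have eint : ∀ u : ℝ, ∫ r in Set.Ioi (0 : ℝ), r ^ (2 * n + 1) * besselKernel (1 - c) (r ^ 2) u =
      n.factorial / 2 * Real.exp ((n + c) * u - Real.exp u) := by
    intro u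
    simp only [ek]
    rw [integral_mul_const, (hmom u).2, neg_neg, ← Real.exp_nat_mul, mul_div_right_comm, mul_assoc,
      ← Real.exp_add]
    congr 2
    push_cast
    ring
  have hnc : 0 < n + c := by positivity
  have hgam := integrable_exp_mul_sub_exp hnc
  have hcont : Continuous fun p : ℝ × ℝ =>
      p.1 ^ (2 * n + 1) * besselKernel (1 - c) (p.1 ^ 2) p.2 := by
    unfold besselKernel; fun_prop
  have hprod : Integrable (fun p : ℝ × ℝ =>
      p.1 ^ (2 * n + 1) * besselKernel (1 - c) (p.1 ^ 2) p.2)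
      ((volume.restrict (Set.Ioi 0)).prod volume) := by
    rw [integrable_prod_iff' hcont.aestronglyMeasurable]
    refine ⟨ae_of_all _ fun u => ?_, ?_⟩
    · simp only [ek]
      exact (hmom u).1.integrable.mul_const _
    · refine (hgam.1.const_mul (n.factorial / 2 : ℝ)).congr (ae_of_all _ fun u => ?_)
      dsimp only
      rw [← eint u]
      refine setIntegral_congr_fun measurableSet_Ioi fun r hr => ?_
      have hr' : 0 < r := hr
      exact (Real.norm_of_nonneg (mul_nonneg (by positivity) (Real.exp_pos _).le)).symm
  have eG : ∀ r : ℝ, ∫ u, r ^ (2 * n + 1) * besselKernel (1 - c) (r ^ 2) u =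
      r ^ (2 * n + 1) * besselG (1 - c) (r ^ 2) := fun r => integral_const_mul _ _
  refine ⟨hprod.integral_prod_left.congr (ae_of_all _ fun r => eG r), ?_⟩
  have hswap := integral_integral_swap (f := fun r u =>
    r ^ (2 * n + 1) * besselKernel (1 - c) (r ^ 2) u) hprod
  simp only [eG, eint] at hswap
  rw [hswap, integral_const_mul, hgam.2]
  ring

end RadialDensity

/-! ### The case σ = 1 - s². -/

section CaseB

variable {α β : ℝ} {Ψ : ℕ → ℝ[X]} {m : ℕ}

/-- The coefficients `1 / √(n! Γ(n + 2 m - α))`. -/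
def coeffB (α : ℝ) (m n : ℕ) : ℝ := (√(n.factorial * Real.Gamma (n + 2 * m - α)))⁻¹

theorem gamma_arg_pos (hα : α < 0) (m n : ℕ) : 0 < (n + 2 * m - α : ℝ) := by
  have : (0 : ℝ) ≤ n := n.cast_nonneg
  have : (0 : ℝ) ≤ m := m.cast_nonneg
  linarith

theorem two_mul_sub_pos (hα : α < 0) (m : ℕ) : 0 < (2 * m - α : ℝ) := by
  simpa using gamma_arg_pos hα m 0

theorem factorial_mul_Gamma_pos (hα : α < 0) (m n : ℕ) :
    0 < n.factorial * Real.Gamma (n + 2 * m - α) :=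
  mul_pos (Nat.cast_pos.2 n.factorial_pos) (Real.Gamma_pos_of_pos (gamma_arg_pos hα m n))

theorem coeffB_pos (hα : α < 0) (m n : ℕ) : 0 < coeffB α m n :=
  inv_pos.2 (Real.sqrt_pos.2 (factorial_mul_Gamma_pos hα m n))

theorem coeffB_sq (hα : α < 0) (m n : ℕ) :
    coeffB α m n ^ 2 = (n.factorial * Real.Gamma (n + 2 * m - α))⁻¹ := by
  rw [coeffB, inv_pow, Real.sq_sqrt (factorial_mul_Gamma_pos hα m n).le]

theorem coeffB_succ (hα : α < 0) (m n : ℕ) :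
    coeffB α m (n + 1) * √(gap .quad α m (n + 1)) = coeffB α m n := by
  have hg : gap .quad α m (n + 1) = (n + 1) * (n + 2 * m - α) := by
    simp only [gap]; push_cast; ring
  have h1 := gamma_arg_pos hα m n
  have h2 : (0 : ℝ) < (n + 1) * (n + 2 * m - α) := by positivity
  have h3 : ((n + 1).factorial * Real.Gamma ((n + 1 : ℕ) + 2 * m - α) : ℝ) =
      (n.factorial * Real.Gamma (n + 2 * m - α)) * ((n + 1) * (n + 2 * m - α)) := by
    rw [show (((n + 1 : ℕ) : ℝ) + 2 * m - α) = (n + 2 * m - α) + 1 by push_cast; ring,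
      Real.Gamma_add_one h1.ne', Nat.factorial_succ]
    push_cast
    ring
  rw [hg, coeffB, coeffB, h3, Real.sqrt_mul (factorial_mul_Gamma_pos hα m n).le, mul_inv,
    mul_assoc, inv_mul_cancel₀ (Real.sqrt_pos.2 h2).ne', mul_one]

theorem termB_eq (k : Kind) (α β : ℝ) (Ψ : ℕ → ℝ[X]) (m : ℕ) (z : ℂ) (n : ℕ) :
    termB k α β Ψ m z n = (z ^ n * (coeffB α m n : ℂ)) • ket k α β Ψ m n := by
  rw [termB, coeffB, div_eq_mul_inv, Complex.ofReal_inv]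

theorem cohB_eq (k : Kind) (α β : ℝ) (Ψ : ℕ → ℝ[X]) (m : ℕ) (z : ℂ) :
    cohB k α β Ψ m z =
      ((√(Real.Gamma (2 * m - α)) : ℝ) : ℂ) • cohVec k α β Ψ m (coeffB α m) z := by
  simp only [cohB, cohVec, termB_eq]

theorem Gamma_add_nat_eq {c : ℝ} (hc : 0 < c) (n : ℕ) :
    Real.Gamma (n + c) = Real.Gamma c * (ascPochhammer ℝ n).eval c := by
  induction n with
  | zero => simp
  | succ n ih =>
    have : 0 < n + c := by positivity
    rw [ascPochhammer_succ_eval, Nat.cast_succ, show (n : ℝ) + 1 + c = (n + c) + 1 by ring,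
      Real.Gamma_add_one this.ne', ih]
    ring

theorem inner_cohB_self (h : Admissible .quad α β)
    (hΨ : ∀ l, IsPolynomialSolution .quad α β l (Ψ l)) (z : ℂ) :
    ⟪cohB .quad α β Ψ m z, cohB .quad α β Ψ m z⟫_ℂ =
      ((hyp0F1 (2 * m - α) (‖z‖ ^ 2) : ℝ) : ℂ) := by
  have hα := h.alpha_neg
  have hc := two_mul_sub_pos hα m
  have hΓ := Real.Gamma_pos_of_pos hc
  have h1 := hasSum_inner_cohVec_self h hΨ (coeffB_pos hα m) (coeffB_succ hα m) z
  rw [cohB_eq, inner_smul_left, inner_smul_right, Complex.conj_ofReal, ← mul_assoc,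
    ← Complex.ofReal_mul, Real.mul_self_sqrt hΓ.le, hyp0F1, Complex.ofReal_tsum, ← h1.tsum_eq,
    ← tsum_mul_left]
  refine tsum_congr fun n => ?_
  rw [← Complex.ofReal_mul, coeffB_sq hα, add_sub_assoc, Gamma_add_nat_eq hc]
  congr 1
  field_simp

theorem bgDensity_nonneg (hα : α < 0) (m : ℕ) {r : ℝ} (hr : 0 < r) : 0 ≤ bgDensity α m r := by
  rw [bgDensity_eq α m hr]
  have := Real.Gamma_pos_of_pos (two_mul_sub_pos hα m)
  have := Real.pi_pos
  have := besselG_nonneg (1 - (2 * m - α)) (r ^ 2)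
  positivity

theorem aemeasurable_bgDensity (α : ℝ) (m : ℕ) :
    AEMeasurable (bgDensity α m) (volume.restrict (Set.Ioi 0)) := by
  have hc : ContinuousOn (bgDensity α m) (Set.Ioi 0) := by
    have : ContinuousOn (fun r : ℝ => r / (Real.pi * Real.Gamma (2 * m - α)) *
        besselG (1 - (2 * m - α)) (r ^ 2)) (Set.Ioi 0) :=
      (Continuous.continuousOn (by fun_prop)).mul ((continuousOn_besselG _).comp
        (Continuous.continuousOn (by fun_prop)) fun r hr => pow_pos (show 0 < r from hr) 2)
    exact this.congr fun r hr => bgDensity_eq α m hr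
  exact hc.aemeasurable measurableSet_Ioi

theorem resolvesIdentity_cohB (h : Admissible .quad α β)
    (hΨ : ∀ l, IsPolynomialSolution .quad α β l (Ψ l)) :
    ResolvesIdentity 1 (bgMeasure α m) (cohB .quad α β Ψ m) := by
  have hα := h.alpha_neg
  have hc := two_mul_sub_pos hα m
  have hΓ := Real.Gamma_pos_of_pos hc
  have e : ∀ (n : ℕ), ∀ r ∈ Set.Ioi (0 : ℝ), bgDensity α m r *
      (r ^ n * (coeffB α m n * √(Real.Gamma (2 * m - α)))) ^ 2 =
      coeffB α m n ^ 2 / Real.pi *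
        (r ^ (2 * n + 1) * besselG (1 - (2 * m - α)) (r ^ 2)) := by
    intro n r hr
    rw [bgDensity_eq α m hr, mul_pow, mul_pow, Real.sq_sqrt hΓ.le]
    have := Real.pi_pos.ne'
    field_simp
    ring
  -- `bgMeasure α m` unfolds to `polarMeasure (bgDensity α m)`. The normalization of |z⟩ does not
  -- depend on z, so the radial factor `h` is constant and cancels the Γ(2m - α) in the density.
  refine resolvesIdentity_polarMeasure (ketBasis h hΨ m) (w := bgDensity α m) (d := coeffB α m)
    (h := fun _ => √(Real.Gamma (2 * m - α))) (aemeasurable_bgDensity α m)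
    (fun r hr => bgDensity_nonneg hα m hr) measurable_const (fun z n => ?_) (fun n => ?_)
    (fun n => ?_)
  · rw [ketBasis_apply, cohB_eq, inner_smul_right,
      inner_ket_cohVec h hΨ (coeffB_pos hα m) (coeffB_succ hα m)]
    push_cast
    ring
  · exact IntegrableOn.congr_fun ((besselG_moment hc n).1.integrable.const_mul _)
      (fun r hr => (e n r hr).symm) measurableSet_Ioi
  · rw [setIntegral_congr_fun measurableSet_Ioi (e n), integral_const_mul, (besselG_moment hc n).2,
      coeffB_sq hα, add_sub_assoc]
    have := Real.pi_pos.ne'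
    have : Real.Gamma (n + (2 * m - α)) ≠ 0 := (Real.Gamma_pos_of_pos (by positivity)).ne'
    have : (n.factorial : ℝ) ≠ 0 := Nat.cast_ne_zero.2 n.factorial_ne_zero
    field_simp

end CaseB

end CoherentStates

end

theorem theorem3 (k : CoherentStates.Kind) (α β : ℝ) (hαβ : CoherentStates.Admissible k α β)
    (Ψ : ℕ → Polynomial ℝ) (hΨ : ∀ l, CoherentStates.IsPolynomialSolution k α β l (Ψ l)) (m : ℕ) :
    (∃! U : CoherentStates.Hil k α β ≃ₗᵢ[ℂ] CoherentStates.Hil k α β,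
      CoherentStates.IsShift k α β Ψ m U) ∧
    ∀ U : CoherentStates.Hil k α β ≃ₗᵢ[ℂ] CoherentStates.Hil k α β,
      CoherentStates.IsShift k α β Ψ m U →
      ((k = .one ∨ k = .lin) →
        (∀ z : ℂ, Summable (CoherentStates.termA k α β Ψ m z)) ∧
        Continuous (CoherentStates.cohA k α β Ψ m) ∧
        (∀ z : ℂ, ⟪CoherentStates.cohA k α β Ψ m z, CoherentStates.cohA k α β Ψ m z⟫_ℂ = 1) ∧
        (∀ z : ℂ, CoherentStates.IsEigen (CoherentStates.lowering k α β m U) z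
          (CoherentStates.cohA k α β Ψ m z)) ∧
        CoherentStates.ResolvesIdentity (1 / (Real.pi * (-α))) volume
          (CoherentStates.cohA k α β Ψ m)) ∧
      (k = .quad →
        (∀ z : ℂ, Summable (CoherentStates.termB k α β Ψ m z)) ∧
        Continuous (CoherentStates.cohB k α β Ψ m) ∧
        (∀ z : ℂ, ⟪CoherentStates.cohB k α β Ψ m z, CoherentStates.cohB k α β Ψ m z⟫_ℂ =
          ((CoherentStates.hyp0F1 (2 * m - α) (‖z‖ ^ 2) : ℝ) : ℂ)) ∧
        (∀ z : ℂ, CoherentStates.IsEigen (CoherentStates.lowering k α β m U) z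
          (CoherentStates.cohB k α β Ψ m z)) ∧
        (∀ r : ℝ, 0 < r → 0 ≤ CoherentStates.bgDensity α m r) ∧
        CoherentStates.ResolvesIdentity 1 (CoherentStates.bgMeasure α m)
          (CoherentStates.cohB k α β Ψ m)) := by
  refine ⟨CoherentStates.existsUnique_isShift hαβ hΨ m, fun U hU => ⟨fun hk => ?_, ?_⟩⟩
  · have hα := hαβ.alpha_neg
    have hd := CoherentStates.coeffA_pos hα
    have hrec := CoherentStates.coeffA_succ hα hk m
    refine ⟨fun z => ?_, ?_, CoherentStates.inner_cohA_self hαβ hΨ hk, fun z => ?_,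
      CoherentStates.resolvesIdentity_cohA hαβ hΨ hk⟩
    · exact (CoherentStates.summable_cohVec hαβ hΨ hd hrec z).congr fun n =>
        (CoherentStates.termA_eq _ α β Ψ m z n).symm
    · have h := CoherentStates.continuous_cohVec hαβ hΨ hd hrec
      have he : CoherentStates.cohA k α β Ψ m = _ :=
        funext (CoherentStates.cohA_eq k α β Ψ m)
      rw [he]
      have hc : Continuous fun z : ℂ => ((Real.exp (‖z‖ ^ 2 / (2 * α)) : ℝ) : ℂ) := by fun_prop
      exact hc.smul h
    · rw [CoherentStates.cohA_eq]
      exact (CoherentStates.isEigen_cohVec hαβ hΨ hU hd hrec z).smul _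
  · rintro rfl
    have hα := hαβ.alpha_neg
    have hd := CoherentStates.coeffB_pos hα m
    have hrec := CoherentStates.coeffB_succ hα m
    refine ⟨fun z => ?_, ?_, CoherentStates.inner_cohB_self hαβ hΨ, fun z => ?_,
      fun r hr => CoherentStates.bgDensity_nonneg hα m hr,
      CoherentStates.resolvesIdentity_cohB hαβ hΨ⟩
    · exact (CoherentStates.summable_cohVec hαβ hΨ hd hrec z).congr fun n =>
        (CoherentStates.termB_eq _ α β Ψ m z n).symm
    · have h := CoherentStates.continuous_cohVec hαβ hΨ hd hrec
      have he : CoherentStates.cohB .quad α β Ψ m = _ :=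
        funext (CoherentStates.cohB_eq .quad α β Ψ m)
      rw [he]
      have hc : Continuous fun _ : ℂ => ((√(Real.Gamma (2 * m - α)) : ℝ) : ℂ) :=
        continuous_const
      exact hc.smul h
    · rw [CoherentStates.cohB_eq]
      exact (CoherentStates.isEigen_cohVec hαβ hΨ hU hd hrec z).smul _
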